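/- Let $m\ge 1$ be an integer, $\beta\ge 0$, and $f(i)=i+\beta$ for $i\ge 1$. Consider the random multigraphs $(\mathcal G_n)_{n\ge 1}$ built as follows: $\mathcal G_1$ consists of the two vertices $v_0$ (the root) and $v_1$ joined by $m$ edges; for $n\ge 2$, $\mathcal G_n$ is obtained from $\mathcal G_{n-1}$ by adding a vertex $v_n$ and $m$ edges from $v_n$, attached one after the other, where the other end of each edge is one of $v_0,\dots,v_{n-1}$, chosen with probability proportional to $f(\text{degree})$, the degrees being updated after each edge. For $K\ge 1$ let $H_K$ map a graph to a set of $K$ of its vertices of largest degree (all its vertices if there are fewer than $K$), ties being broken arbitrarily. For $\varepsilon\in(0,1)$ let $K_\Psi(\varepsilon)$ be the smallest $K\ge 1$ such that $$\liminf_{n\to\infty} P\big(v_0\in H_K(\mathcal G_n)\big)\ge 1-\varepsilon ,$$ with $K_\Psi(\varepsilon)=\infty$ if there is no such $K$. Then there exist constants $C_1,C_1',C_2>0$, depending only on $m$ and $\beta$, such that for every $\varepsilon\in(0,1)$ $$\frac{C_1'}{\varepsilon^{\frac{2m+\beta}{m(m+\beta)}}}\;\le\; K_\Psi(\varepsilon)\;\le\;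 \frac{C_1}{\varepsilon^{\frac{2m+\beta}{m(m+\beta)}}}\exp\left(\sqrt{C_2\log\frac1\varepsilon}\right).$$ In particular $K_\Psi(\varepsilon)<\infty$. -/

import Mathlib

open Filter

noncomputable section

namespace RootFinding

/-- A finite directed multigraph on the vertex set `V`: the multiset of its directed edges
`(tail, head)`, parallel edges being counted with multiplicity. -/
abbrev MultiDigraph (V : Type) : Type := Multiset (V × V)

/-- The degree of `v`: the number of edge ends attached to `v`. -/
def degree {V : Type} [DecidableEq V] (G : MultiDigraph V) (v : V) : ℕ :=
  (G.map Prod.fst).count v + (G.map Prod.snd).count v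

/-! ### The attachment model

The vertices of `𝒢ₙ` are `v₀, …, vₙ`, represented by `Fin (n + 1)`; the root `v₀` is `0`.
The attachment function is `f : {1, 2, …} → (0, ∞)`. Degrees of vertices that can be chosen as
targets are always at least `1`, so the value `f 0` is never used. -/

/-- The random target of an edge issued by the newest vertex `Fin.last (n + 1)`: one of the older
vertices `v₀, …, vₙ`, chosen with probability proportional to `f` of its degree in `G`. -/
def targetLaw (f : ℕ → Set.Ioi (0 : ℝ)) {n : ℕ} (G : MultiDigraph (Fin (n + 2))) :
    PMF (Fin (n + 1)) :=
  PMF.normalize (fun i => ENNReal.ofReal (f (degree G i.castSucc) : ℝ))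
    (by
      intro h
      have h0 := ENNReal.tsum_eq_zero.mp h 0
      exact absurd (ENNReal.ofReal_eq_zero.mp h0) (not_le.mpr (f _).2))
    (by
      rw [tsum_fintype]
      exact ENNReal.sum_ne_top.mpr fun _ _ => ENNReal.ofReal_ne_top)

/-- Attach one edge from the newest vertex to a random older vertex. -/
def attachEdge (f : ℕ → Set.Ioi (0 : ℝ)) {n : ℕ} (G : MultiDigraph (Fin (n + 2))) :
    PMF (MultiDigraph (Fin (n + 2))) :=
  (targetLaw f G).map fun i => (Fin.last (n + 1), i.castSucc) ::ₘ G

/-- Attach `k` edges from the newest vertex one after the other, the degrees being updated after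
each attachment. -/
def attachEdges (f : ℕ → Set.Ioi (0 : ℝ)) {n : ℕ} :
    ℕ → MultiDigraph (Fin (n + 2)) → PMF (MultiDigraph (Fin (n + 2)))
  | 0, G => PMF.pure G
  | k + 1, G => (attachEdges f k G).bind (attachEdge f)

/-- Add a new isolated vertex `Fin.last (n + 1)`. -/
def addVertex {n : ℕ} (G : MultiDigraph (Fin (n + 1))) : MultiDigraph (Fin (n + 2)) :=
  G.map fun e => (e.1.castSucc, e.2.castSucc)

/-- The law of the random graph `𝒢ₙ` with attachment function `f` in which every new vertex
attaches through `m` edges. `𝒢₁` consists of `v₀`, `v₁` and `m` edges between them, and `𝒢ₙ` is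
obtained from `𝒢ₙ₋₁` by adding `vₙ` and attaching its `m` edges sequentially. (For `n = 0` we put
the root without edges; the model starts at `n = 1`.) -/
def graphLaw (f : ℕ → Set.Ioi (0 : ℝ)) (m : ℕ) : (n : ℕ) → PMF (MultiDigraph (Fin (n + 1)))
  | 0 => PMF.pure 0
  | 1 => PMF.pure (Multiset.replicate m (1, 0))
  | n + 2 => (graphLaw f m (n + 1)).bind fun G => attachEdges f m (addVertex G)

/-! ### Centrality and root finding -/

/-- `S` is a set of `K` most central vertices for the score `Ψ` (all vertices if there are fewer
than `K`). With ties there can be several such sets. -/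
def IsMostCentral {V : Type} [Fintype V] (Ψ : V → ℝ) (K : ℕ) (S : Finset V) : Prop :=
  S.card = min K (Fintype.card V) ∧ ∀ v ∈ S, ∀ w, w ∉ S → Ψ w ≤ Ψ v

/-- A way to select vertices for every budget `K` and every graph on `v₀, …, vₙ`. -/
abbrev Selection : Type :=
  (K : ℕ) → (n : ℕ) → MultiDigraph (Fin (n + 1)) → Finset (Fin (n + 1))

/-- `H K` maps each graph to a set of `K` vertices of largest degree, ties being broken in
an arbitrary way. -/
def IsDegreeSelection (H : Selection) : Prop :=
  ∀ (K n : ℕ) (G : MultiDigraph (Fin (n + 1))), 1 ≤ K →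
    IsMostCentral (fun v => (degree G v : ℝ)) K (H K n G)

/-- `h` is a root finding algorithm with error tolerance `ε` for the random graphs with laws
`P n`: the liminf of the probabilities that the root belongs to the selected set is at
least `1 - ε`. -/
def IsRootFinding (P : (n : ℕ) → PMF (MultiDigraph (Fin (n + 1))))
    (h : (n : ℕ) → MultiDigraph (Fin (n + 1)) → Finset (Fin (n + 1))) (ε : ℝ) : Prop :=
  ENNReal.ofReal (1 - ε) ≤
    liminf (fun n => (P n).toOuterMeasure {G | (0 : Fin (n + 1)) ∈ h n G}) atTop

/-- The smallest budget `K ≥ 1` for which `H K` is a root finding algorithm with error tolerance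
`ε`; it is `⊤` if there is none. -/
def budget (P : (n : ℕ) → PMF (MultiDigraph (Fin (n + 1)))) (H : Selection) (ε : ℝ) : ℕ∞ :=
  sInf {k : ℕ∞ | ∃ K : ℕ, 1 ≤ K ∧ IsRootFinding P (H K) ε ∧ k = (K : ℕ∞)}

end RootFinding

end

/-! Put a = m/(2m+β) (`growthExponent`) and b = m+β; the exponent of 1/ε is then 1/(ab). The total
weight of the possible targets is deterministic. Hence, if (d+β)(h(d+1) − h(d)) = c·h(d), each new
edge multiplies the mean of h(degree) by exactly 1 + c/weight (`isMultiplicative_degree`,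
`expect_graphLaw`), and between times k and n these factors multiply to the order of (n/k)^(ca). Two
families are used: `risingWeight` with c = p gives positive moments, `decay` with c = −q, q < b,
gives negative ones. Markov's inequality turns both into tail bounds around (n/k)^a for the degree
of the vertex k.

Upper bound: if the root is missed, some vertex k ≥ K has at least the degree of the root. Both are
compared with the threshold e^(−D) n^a. The root falls below it with probability at most
b/(b−q)·e^(q(2−D)) (`prob_root_le`), and the vertex k exceeds it with probability at most
e^(p(b+p+1+D)) k^(−pa) (`prob_vertex_ge`); `prob_notMem_le` adds these up. With L = log(1/ε), the
choices D = L/b + O(√(1+L)), p of order √(1+L) and b − q of order 1/√(1+L) make K = exp(L/(ab) +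
O(√(1+L))) sufficient (`exists_parameters`).

Lower bound: the root receives no edge from the vertices 2, …, N with probability at least a
constant times N^(−ab) (`exp_le_idleProb`). Take N = MK with M a large constant. On this event the
degree of the root is typically of order (n/N)^a, while at least K of the vertices 1, …, 2K have
degree at least a constant times (n/K)^a and outrank it. So the root is missed with probability at
least c·K^(−ab) (`le_prob_notMem`), which forces ε ≥ c·K^(−ab). -/

noncomputable section

namespace RootFinding

/-! ### Expectations under probability mass functions -/

/-- The expectation of `φ` under `p`. -/
def expect {α : Type} (p : PMF α) (φ : α → ENNReal) : ENNReal := ∑' x, p x * φ x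

theorem expect_pure {α : Type} (a : α) (φ : α → ENNReal) : expect (PMF.pure a) φ = φ a := by
  unfold expect
  rw [tsum_eq_single a]
  · simp
  · intro b hb
    simp [hb]

theorem expect_bind {α γ : Type} (p : PMF α) (q : α → PMF γ) (φ : γ → ENNReal) :
    expect (p.bind q) φ = expect p fun a => expect (q a) φ := by
  unfold expect
  simp_rw [PMF.bind_apply, ← ENNReal.tsum_mul_right, ← ENNReal.tsum_mul_left]
  rw [ENNReal.tsum_comm]
  simp_rw [mul_assoc]

theorem expect_map {α γ : Type} (p : PMF α) (g : α → γ) (φ : γ → ENNReal) :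
    expect (p.map g) φ = expect p fun a => φ (g a) := by
  rw [PMF.map, expect_bind]
  simp [expect_pure]

theorem expect_congr {α : Type} {p : PMF α} {φ ψ : α → ENNReal}
    (h : ∀ a ∈ p.support, φ a = ψ a) : expect p φ = expect p ψ := by
  refine tsum_congr fun a => ?_
  by_cases ha : a ∈ p.support
  · rw [h a ha]
  · simp [(PMF.apply_eq_zero_iff p a).2 ha]

theorem expect_const_mul {α : Type} (p : PMF α) (c : ENNReal) (φ : α → ENNReal) :
    expect p (fun a => φ a * c) = expect p φ * c := by
  simp_rw [expect, ← mul_assoc, ENNReal.tsum_mul_right]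

theorem expect_sum {α ι : Type} (p : PMF α) (s : Finset ι) (φ : ι → α → ENNReal) :
    expect p (fun a => ∑ i ∈ s, φ i a) = ∑ i ∈ s, expect p (φ i) := by
  simp_rw [expect, Finset.mul_sum]
  exact Summable.tsum_finsetSum fun _ _ => ENNReal.summable

theorem toOuterMeasure_mul_le_expect {α : Type} (p : PMF α) (S : Set α) (φ : α → ENNReal)
    (y : ENNReal) (h : ∀ a ∈ p.support, a ∈ S → y ≤ φ a) :
    p.toOuterMeasure S * y ≤ expect p φ := by
  rw [PMF.toOuterMeasure_apply, ← ENNReal.tsum_mul_right]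
  refine ENNReal.tsum_le_tsum fun a => ?_
  by_cases haS : a ∈ S
  · rw [Set.indicator_of_mem haS]
    by_cases ha : a ∈ p.support
    · gcongr
      exact h a ha haS
    · simp [(PMF.apply_eq_zero_iff p a).2 ha]
  · simp [haS]

/-- Markov's inequality, with the lower bound on φ needed only on the support, where the
deterministic invariants of the graph are available. -/
theorem toOuterMeasure_le_of_expect {α : Type} (p : PMF α) (S : Set α) (φ : α → ℝ)
    {x y z : ℝ} (hy : 0 < y) (h : ∀ a ∈ p.support, a ∈ S → y ≤ φ a)
    (hx : expect p (fun a => ENNReal.ofReal (φ a)) ≤ ENNReal.ofReal x) (hxz : x ≤ z * y) :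
    p.toOuterMeasure S ≤ ENNReal.ofReal z := by
  have h1 := toOuterMeasure_mul_le_expect p S (fun a => ENNReal.ofReal (φ a)) (ENNReal.ofReal y)
    fun a ha haS => ENNReal.ofReal_le_ofReal (h a ha haS)
  have h2 := (h1.trans hx).trans (ENNReal.ofReal_le_ofReal hxz)
  rw [ENNReal.ofReal_mul' hy.le] at h2
  exact (ENNReal.mul_le_mul_iff_left (ENNReal.ofReal_pos.2 hy).ne' ENNReal.ofReal_ne_top).1 h2

theorem toOuterMeasure_add_compl {α : Type} (p : PMF α) (S : Set α) :
    p.toOuterMeasure S + p.toOuterMeasure Sᶜ = 1 := by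
  rw [PMF.toOuterMeasure_apply, PMF.toOuterMeasure_apply, ← ENNReal.tsum_add, ← p.tsum_coe]
  refine tsum_congr fun a => ?_
  by_cases h : a ∈ S <;> simp [h]

theorem toOuterMeasure_eq_expect {α : Type} (p : PMF α) (S : Set α) [DecidablePred (· ∈ S)] :
    p.toOuterMeasure S = expect p fun a => ENNReal.ofReal (if a ∈ S then 1 else 0) := by
  rw [PMF.toOuterMeasure_apply]
  refine tsum_congr fun a => ?_
  by_cases h : a ∈ S <;> simp [h]

/-! ### Multigraphs with vertices labelled by natural numbers -/

/-- The multigraph on `ℕ` obtained by replacing vertices by their indices. -/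
def labels {n : ℕ} (G : MultiDigraph (Fin n)) : MultiDigraph ℕ :=
  G.map fun e => (e.1.val, e.2.val)

theorem degree_labels {n : ℕ} (G : MultiDigraph (Fin n)) (v : Fin n) :
    degree (labels G) v.val = degree G v := by
  unfold degree labels
  rw [Multiset.map_map, Multiset.map_map,
    ← Multiset.count_map_eq_count' Fin.val _ Fin.val_injective v,
    ← Multiset.count_map_eq_count' Fin.val _ Fin.val_injective v, Multiset.map_map,
    Multiset.map_map]
  rfl

/-- This is what labels by natural numbers are for: a new isolated vertex leaves the multigraph
unchanged, so one functional can be followed through all times although the vertex type varies. -/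
theorem labels_addVertex {n : ℕ} (G : MultiDigraph (Fin (n + 1))) :
    labels (addVertex G) = labels G := by
  unfold labels addVertex
  rw [Multiset.map_map]
  rfl

theorem labels_cons {n : ℕ} (G : MultiDigraph (Fin (n + 2))) (i : Fin (n + 1)) :
    labels ((Fin.last (n + 1), i.castSucc) ::ₘ G) = (n + 1, i.val) ::ₘ labels G := by
  simp [labels]

theorem degree_cons {V : Type} [DecidableEq V] (M : MultiDigraph V) (u v w : V) :
    degree ((u, v) ::ₘ M) w = degree M w + (if w = u then 1 else 0) + if w = v then 1 else 0 := by
  simp only [degree, Multiset.map_cons, Multiset.count_cons]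
  omega

theorem degree_cons_old {n i k : ℕ} (M : MultiDigraph ℕ) (hk : k ≤ n) :
    degree ((n + 1, i) ::ₘ M) k = degree M k + if k = i then 1 else 0 := by
  rw [degree_cons, if_neg (by omega)]
  omega

theorem degree_eq_zero {M : MultiDigraph ℕ} {k : ℕ} (h : ∀ e ∈ M, e.1 < k ∧ e.2 < k) :
    degree M k = 0 := by
  simp only [degree, Nat.add_eq_zero_iff, Multiset.count_eq_zero, Multiset.mem_map, not_exists,
    not_and]
  exact ⟨fun e he h1 => by have := h e he; omega, fun e he h1 => by have := h e he; omega⟩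

/-! ### Invariants of the attachment model -/

/-- The deterministic properties of the graph while the vertex `n + 1` is being attached,
after `j` of its edges have been drawn. -/
structure Attaching (m n j : ℕ) (M : MultiDigraph ℕ) : Prop where
  le_degree : ∀ i ≤ n, m ≤ degree M i
  sum_degree : ∑ i ∈ Finset.range (n + 1), degree M i = 2 * m * n + j
  degree_new : degree M (n + 1) = j
  tail_le : ∀ e ∈ M, e.1 ≤ n + 1
  head_le : ∀ e ∈ M, e.2 ≤ n

theorem Attaching.cons {m n j i : ℕ} {M : MultiDigraph ℕ} (h : Attaching m n j M) (hi : i ≤ n) :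
    Attaching m n (j + 1) ((n + 1, i) ::ₘ M) where
  le_degree k hk := by
    rw [degree_cons_old M hk]
    exact (h.le_degree k hk).trans (Nat.le_add_right _ _)
  sum_degree := by
    rw [Finset.sum_congr rfl fun k hk =>
      degree_cons_old M (Nat.lt_succ_iff.1 (Finset.mem_range.1 hk)), Finset.sum_add_distrib,
      h.sum_degree, Finset.sum_ite_eq', if_pos (Finset.mem_range.2 (by omega))]
    rfl
  degree_new := by
    rw [degree_cons, h.degree_new, if_pos rfl, if_neg (by omega)]
  tail_le e he := by
    rcases Multiset.mem_cons.1 he with rfl | he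
    · exact le_rfl
    · exact h.tail_le e he
  head_le e he := by
    rcases Multiset.mem_cons.1 he with rfl | he
    · exact hi
    · exact h.head_le e he

theorem Attaching.succ {m n : ℕ} {M : MultiDigraph ℕ} (h : Attaching m n m M) :
    Attaching m (n + 1) 0 M where
  le_degree k hk := by
    rcases Nat.lt_or_eq_of_le hk with hk | rfl
    · exact h.le_degree k (by omega)
    · exact h.degree_new.ge
  sum_degree := by
    rw [Finset.sum_range_succ, h.sum_degree, h.degree_new]
    ring
  degree_new := degree_eq_zero fun e he => by
    have := h.tail_le e he
    have := h.head_le e he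
    omega
  tail_le e he := (h.tail_le e he).trans (Nat.le_succ _)
  head_le e he := (h.head_le e he).trans (Nat.le_succ _)

theorem Attaching.degree_root {m j : ℕ} {M : MultiDigraph ℕ} (h : Attaching m 0 j M) :
    degree M 0 = j := by
  simpa using h.sum_degree

theorem attaching_attachEdges (f : ℕ → Set.Ioi (0 : ℝ)) {m n : ℕ} (G : MultiDigraph (Fin (n + 2)))
    (hG : Attaching m n 0 (labels G)) (j : ℕ) :
    ∀ G' ∈ (attachEdges f j G).support, Attaching m n j (labels G') := by
  induction j with
  | zero =>
    intro G' hG'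
    rw [attachEdges, PMF.mem_support_pure_iff] at hG'
    rwa [hG']
  | succ j ih =>
    intro G' hG'
    rw [attachEdges, PMF.mem_support_bind_iff] at hG'
    obtain ⟨G₁, h₁, h₂⟩ := hG'
    rw [attachEdge, PMF.mem_support_map_iff] at h₂
    obtain ⟨i, -, rfl⟩ := h₂
    rw [labels_cons]
    exact (ih G₁ h₁).cons (Nat.lt_succ_iff.1 i.isLt)

theorem labels_first (m : ℕ) :
    labels (Multiset.replicate m ((1 : Fin 2), (0 : Fin 2))) = Multiset.replicate m (1, 0) := by
  simp [labels]

theorem attaching_first (m : ℕ) : Attaching m 0 m (Multiset.replicate m (1, 0)) where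
  le_degree k hk := by
    obtain rfl : k = 0 := by omega
    simp [degree, Multiset.count_replicate]
  sum_degree := by simp [degree, Multiset.count_replicate]
  degree_new := by simp [degree, Multiset.count_replicate]
  tail_le e he := by simp [Multiset.eq_of_mem_replicate he]
  head_le e he := by simp [Multiset.eq_of_mem_replicate he]

theorem attaching_graphLaw (f : ℕ → Set.Ioi (0 : ℝ)) (m n : ℕ) :
    ∀ G ∈ (graphLaw f m (n + 1)).support, Attaching m n m (labels G) := by
  induction n with
  | zero =>
    intro G hG
    rw [graphLaw, PMF.mem_support_pure_iff] at hG
    rw [hG, labels_first]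
    exact attaching_first m
  | succ n ih =>
    intro G hG
    rw [graphLaw, PMF.mem_support_bind_iff] at hG
    obtain ⟨G₁, h₁, h₂⟩ := hG
    refine attaching_attachEdges f _ ?_ m G h₂
    rw [labels_addVertex]
    exact (ih G₁ h₁).succ

/-! ### Evolution of expectations -/

/-- The total weight of the vertices `0, …, n` when the vertex `n + 1` has issued `j` edges. -/
def totalWeight (m : ℕ) (β : ℝ) (n j : ℕ) : ℝ := 2 * m * n + j + (n + 1) * β

theorem Attaching.sum_weight {m n j : ℕ} {M : MultiDigraph ℕ} (h : Attaching m n j M) (β : ℝ) :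
    ∑ i ∈ Finset.range (n + 1), ((degree M i : ℝ) + β) = totalWeight m β n j := by
  rw [Finset.sum_add_distrib, ← Nat.cast_sum, h.sum_degree]
  simp [totalWeight]

theorem totalWeight_pos {m : ℕ} (hm : 1 ≤ m) {β : ℝ} (hβ : 0 ≤ β) {n : ℕ} (hn : 1 ≤ n) (j : ℕ) :
    0 < totalWeight m β n j := by
  have h1 : (1 : ℝ) ≤ m := by exact_mod_cast hm
  have h2 : (1 : ℝ) ≤ n := by exact_mod_cast hn
  unfold totalWeight
  positivity

/-- `Φ` is, on average, multiplied by `1 + c / totalWeight` when one edge issued by `n + 1` is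
attached. -/
def IsMultiplicative (m : ℕ) (β : ℝ) (n : ℕ) (Φ : MultiDigraph ℕ → ℝ) (c : ℝ) : Prop :=
  ∀ (j : ℕ) (M : MultiDigraph ℕ), Attaching m n j M →
    ∑ i ∈ Finset.range (n + 1), ((degree M i : ℝ) + β) * Φ ((n + 1, i) ::ₘ M) =
      Φ M * (totalWeight m β n j + c)

/-- The factor by which a function with increment `c` is multiplied on average when the vertex
`n + 1` is added. -/
def stepFactor (m : ℕ) (β : ℝ) (c : ℝ) (n : ℕ) : ℝ :=
  ∏ j ∈ Finset.range m, (1 + c / totalWeight m β n j)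

variable {m : ℕ} {β : ℝ} {f : ℕ → Set.Ioi (0 : ℝ)}

theorem expect_attachEdge (hm : 1 ≤ m) (hβ : 0 ≤ β) (hf : ∀ i : ℕ, 1 ≤ i → (f i : ℝ) = i + β)
    {n j : ℕ} (hn : 1 ≤ n) {Φ : MultiDigraph ℕ → ℝ} (hΦ : ∀ M, 0 ≤ Φ M) {c : ℝ}
    (hmul : IsMultiplicative m β n Φ c) (G : MultiDigraph (Fin (n + 2)))
    (hG : Attaching m n j (labels G)) :
    expect (attachEdge f G) (fun G' => ENNReal.ofReal (Φ (labels G'))) =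
      ENNReal.ofReal (Φ (labels G)) * ENNReal.ofReal (1 + c / totalWeight m β n j) := by
  have hW := totalWeight_pos hm hβ hn j
  have hdeg : ∀ i : Fin (n + 1), (f (degree G i.castSucc) : ℝ) = degree (labels G) i.val + β := by
    intro i
    rw [← degree_labels, Fin.val_castSucc]
    -- Possible targets have degree at least m ≥ 1, so the unspecified value `f 0` never enters.
    exact hf _ (hm.trans (hG.le_degree _ (Nat.lt_succ_iff.1 i.isLt)))
  have hpos : ∀ i : ℕ, 0 ≤ (degree (labels G) i : ℝ) + β := fun i => by positivity
  have hZ : ∑' i : Fin (n + 1), ENNReal.ofReal (f (degree G i.castSucc) : ℝ) =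
      ENNReal.ofReal (totalWeight m β n j) := by
    rw [tsum_fintype, ← hG.sum_weight β, Finset.sum_range,
      ENNReal.ofReal_sum_of_nonneg fun i _ => hpos _]
    exact Finset.sum_congr rfl fun i _ => by rw [hdeg]
  rw [attachEdge, expect_map, expect, tsum_fintype]
  simp_rw [labels_cons, targetLaw, PMF.normalize_apply, hZ, hdeg]
  rw [← ENNReal.ofReal_mul (hΦ _), ← ENNReal.ofReal_inv_of_pos hW]
  have h1 : Φ (labels G) * (1 + c / totalWeight m β n j) =
      ∑ i : Fin (n + 1), ((degree (labels G) i.val : ℝ) + β) * (totalWeight m β n j)⁻¹ *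
        Φ ((n + 1, i.val) ::ₘ labels G) := by
    have h2 := hmul j _ hG
    rw [Finset.sum_range] at h2
    have h3 : Φ (labels G) * (1 + c / totalWeight m β n j) =
        (Φ (labels G) * (totalWeight m β n j + c)) * (totalWeight m β n j)⁻¹ := by
      field_simp
    rw [h3, ← h2, Finset.sum_mul]
    exact Finset.sum_congr rfl fun i _ => by ring
  rw [h1, ENNReal.ofReal_sum_of_nonneg fun i _ =>
    mul_nonneg (mul_nonneg (hpos _) (inv_nonneg.2 hW.le)) (hΦ _)]
  refine Finset.sum_congr rfl fun i _ => ?_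
  rw [ENNReal.ofReal_mul (mul_nonneg (hpos _) (inv_nonneg.2 hW.le)), ENNReal.ofReal_mul (hpos _)]

theorem expect_attachEdges (hm : 1 ≤ m) (hβ : 0 ≤ β) (hf : ∀ i : ℕ, 1 ≤ i → (f i : ℝ) = i + β)
    {n : ℕ} (hn : 1 ≤ n) {Φ : MultiDigraph ℕ → ℝ} (hΦ : ∀ M, 0 ≤ Φ M) {c : ℝ}
    (hmul : IsMultiplicative m β n Φ c) (G : MultiDigraph (Fin (n + 2)))
    (hG : Attaching m n 0 (labels G)) (k : ℕ) :
    expect (attachEdges f k G) (fun G' => ENNReal.ofReal (Φ (labels G'))) =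
      ENNReal.ofReal (Φ (labels G)) *
        ∏ j ∈ Finset.range k, ENNReal.ofReal (1 + c / totalWeight m β n j) := by
  induction k with
  | zero => simp [attachEdges, expect_pure]
  | succ k ih =>
    rw [attachEdges, expect_bind, expect_congr fun G' hG' =>
      expect_attachEdge hm hβ hf hn hΦ hmul G' (attaching_attachEdges f G hG k G' hG'),
      expect_const_mul, ih, Finset.prod_range_succ, mul_assoc]

theorem expect_graphLaw_succ (hm : 1 ≤ m) (hβ : 0 ≤ β)
    (hf : ∀ i : ℕ, 1 ≤ i → (f i : ℝ) = i + β)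
    {n : ℕ} (hn : 1 ≤ n) {Φ : MultiDigraph ℕ → ℝ} (hΦ : ∀ M, 0 ≤ Φ M) {c : ℝ}
    (hmul : IsMultiplicative m β n Φ c) (hc : ∀ j, 0 ≤ 1 + c / totalWeight m β n j) :
    expect (graphLaw f m (n + 1)) (fun G => ENNReal.ofReal (Φ (labels G))) =
      expect (graphLaw f m n) (fun G => ENNReal.ofReal (Φ (labels G))) *
        ENNReal.ofReal (stepFactor m β c n) := by
  obtain ⟨n, rfl⟩ : ∃ k, n = k + 1 := ⟨n - 1, by omega⟩
  rw [graphLaw, expect_bind, ← expect_const_mul]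
  refine expect_congr fun G hG => ?_
  have hG' : Attaching m (n + 1) 0 (labels (addVertex G)) := by
    rw [labels_addVertex]
    exact (attaching_graphLaw f m n G hG).succ
  rw [expect_attachEdges hm hβ hf hn hΦ hmul _ hG', labels_addVertex, stepFactor,
    ENNReal.ofReal_prod_of_nonneg fun j _ => hc j]

/-- The increment c may depend on time, and the start k is free: a functional of the vertex k is
multiplicative only once that vertex is a possible target. -/
theorem expect_graphLaw (hm : 1 ≤ m) (hβ : 0 ≤ β)
    (hf : ∀ i : ℕ, 1 ≤ i → (f i : ℝ) = i + β)
    {k n : ℕ} (hk : 1 ≤ k) (hkn : k ≤ n) {Φ : MultiDigraph ℕ → ℝ} (hΦ : ∀ M, 0 ≤ Φ M) (c : ℕ → ℝ)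
    (hmul : ∀ t, k ≤ t → t < n → IsMultiplicative m β t Φ (c t))
    (hc : ∀ t, k ≤ t → t < n → ∀ j, 0 ≤ 1 + c t / totalWeight m β t j) {x : ℝ} (hx : 0 ≤ x)
    (h : expect (graphLaw f m k) (fun G => ENNReal.ofReal (Φ (labels G))) = ENNReal.ofReal x) :
    expect (graphLaw f m n) (fun G => ENNReal.ofReal (Φ (labels G))) =
      ENNReal.ofReal (x * ∏ t ∈ Finset.Ico k n, stepFactor m β (c t) t) := by
  induction n, hkn using Nat.le_induction with
  | base => simpa using h
  | succ n hkn ih =>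
    rw [expect_graphLaw_succ hm hβ hf (hk.trans hkn) hΦ (hmul n hkn (Nat.lt_succ_self n))
      (hc n hkn (Nat.lt_succ_self n)), ih (fun t h1 h2 => hmul t h1 (h2.trans (Nat.lt_succ_self n)))
      (fun t h1 h2 => hc t h1 (h2.trans (Nat.lt_succ_self n))), Finset.prod_Ico_succ_top hkn,
      ← mul_assoc, ← ENNReal.ofReal_mul]
    refine mul_nonneg hx (Finset.prod_nonneg fun t ht => Finset.prod_nonneg fun j _ => ?_)
    rw [Finset.mem_Ico] at ht
    exact hc t ht.1 (by omega) j

theorem expect_graphLaw_eq_of_forall {n : ℕ} {Φ : MultiDigraph ℕ → ℝ} {x : ℝ}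
    (h : ∀ M, Attaching m n m M → Φ M = x) :
    expect (graphLaw f m (n + 1)) (fun G => ENNReal.ofReal (Φ (labels G))) =
      ENNReal.ofReal x := by
  rw [expect_congr (ψ := fun _ => ENNReal.ofReal x) fun G hG => by
    rw [h _ (attaching_graphLaw f m n G hG)]]
  simp [expect, ENNReal.tsum_mul_right, PMF.tsum_coe]

/-! ### Multiplicative functions of the degrees -/

/-- Only an edge with head k changes the functional. That edge has weight d+β, and by hypothesis its
contribution is a multiple of h(d) itself. -/
theorem isMultiplicative_degree {n k : ℕ} (hk : k ≤ n) {h : ℕ → ℝ} {c : ℝ}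
    (hh : ∀ d, m ≤ d → ((d : ℝ) + β) * (h (d + 1) - h d) = c * h d) :
    IsMultiplicative m β n (fun M => h (degree M k)) c := by
  intro j M hM
  have h1 : ∀ i, ((degree M i : ℝ) + β) * h (degree ((n + 1, i) ::ₘ M) k) =
      ((degree M i : ℝ) + β) * h (degree M k) +
        if k = i then ((degree M i : ℝ) + β) * (h (degree M i + 1) - h (degree M i)) else 0 := by
    intro i
    rw [degree_cons_old M hk]
    split_ifs with hki
    · rw [hki]; ring
    · simp
  simp_rw [h1]
  rw [Finset.sum_add_distrib, ← Finset.sum_mul, hM.sum_weight, Finset.sum_ite_eq,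
    if_pos (Finset.mem_range.2 (Nat.lt_succ_of_le hk)), hh _ (hM.le_degree k hk)]
  ring

/-! ### Functionals on the event that the root is idle -/

/-- The indicator that none of the vertices `2, …, N` is attached to the root. -/
def rootIdle (m N : ℕ) (M : MultiDigraph ℕ) : ℝ :=
  if degree (M.filter fun e => e.1 ≤ N) 0 = m then 1 else 0

theorem rootIdle_nonneg (m N : ℕ) (M : MultiDigraph ℕ) : 0 ≤ rootIdle m N M := by
  unfold rootIdle
  split_ifs <;> norm_num

/-- Edges issued by vertices after N are filtered out, so the event is frozen from time N on. -/
theorem rootIdle_cons_of_le {N n i : ℕ} (h : N ≤ n) (M : MultiDigraph ℕ) :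
    rootIdle m N ((n + 1, i) ::ₘ M) = rootIdle m N M := by
  simp [rootIdle, show ¬ n + 1 ≤ N by omega]

theorem rootIdle_eq {N n j : ℕ} (h : n < N) {M : MultiDigraph ℕ} (hM : Attaching m n j M) :
    rootIdle m N M = if degree M 0 = m then 1 else 0 := by
  rw [rootIdle, Multiset.filter_eq_self.2 fun e he => (hM.tail_le e he).trans h]

theorem rootIdle_cons_of_lt {N n i j : ℕ} (h : n < N) (hi : i ≤ n) {M : MultiDigraph ℕ}
    (hM : Attaching m n j M) :
    rootIdle m N ((n + 1, i) ::ₘ M) = rootIdle m N M - if 0 = i then rootIdle m N M else 0 := by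
  rw [rootIdle_eq h hM, rootIdle_eq h (hM.cons hi), degree_cons_old M (Nat.zero_le n)]
  have := hM.le_degree 0 (Nat.zero_le n)
  split_ifs <;> first | omega | norm_num

theorem isMultiplicative_rootIdle_of_le {N n k : ℕ} (hN : N ≤ n) (hk : k ≤ n) {h : ℕ → ℝ} {c : ℝ}
    (hh : ∀ d, m ≤ d → ((d : ℝ) + β) * (h (d + 1) - h d) = c * h d) :
    IsMultiplicative m β n (fun M => rootIdle m N M * h (degree M k)) c := by
  intro j M hM
  have h1 := isMultiplicative_degree hk hh j M hM
  simp only [rootIdle_cons_of_le hN]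
  rw [mul_assoc, ← h1, Finset.mul_sum]
  exact Finset.sum_congr rfl fun i _ => by ring

theorem weight_mul_rootIdle {N n j : ℕ} (h : n < N) {M : MultiDigraph ℕ}
    (hM : Attaching m n j M) :
    ((degree M 0 : ℝ) + β) * rootIdle m N M = (m + β) * rootIdle m N M := by
  rw [rootIdle_eq h hM]
  split_ifs with h0
  · rw [h0]
  · simp

/-- An edge to the root, which has weight m+β while idle, kills the indicator and would not have
changed the degree of k ≥ 1. Its loss is therefore a term −(m+β) added to the increment c. -/
theorem isMultiplicative_rootIdle_of_lt {N n k : ℕ} (hN : n < N) (hk : k ≤ n) (hk1 : 1 ≤ k)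
    {h : ℕ → ℝ} {c : ℝ} (hh : ∀ d, m ≤ d → ((d : ℝ) + β) * (h (d + 1) - h d) = c * h d) :
    IsMultiplicative m β n (fun M => rootIdle m N M * h (degree M k)) (c - (m + β)) := by
  intro j M hM
  have h1 := isMultiplicative_degree hk hh j M hM
  have h2 : ∀ i ∈ Finset.range (n + 1), ((degree M i : ℝ) + β) *
      (rootIdle m N ((n + 1, i) ::ₘ M) * h (degree ((n + 1, i) ::ₘ M) k)) =
      rootIdle m N M * (((degree M i : ℝ) + β) * h (degree ((n + 1, i) ::ₘ M) k)) -
        if 0 = i then ((degree M i : ℝ) + β) * rootIdle m N M * h (degree M k) else 0 := by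
    intro i hi
    have hi' := Nat.lt_succ_iff.1 (Finset.mem_range.1 hi)
    rw [rootIdle_cons_of_lt hN hi' hM]
    split_ifs with h0
    · rw [degree_cons_old M hk, if_neg (by omega)]
      simp; ring
    · ring
  rw [Finset.sum_congr rfl h2, Finset.sum_sub_distrib, ← Finset.mul_sum, h1, Finset.sum_ite_eq,
    if_pos (Finset.mem_range.2 (Nat.succ_pos n)), weight_mul_rootIdle hN hM]
  ring

/-- For arbitrary h: as long as the indicator survives, the degree of the root does not move. -/
theorem isMultiplicative_rootIdle_root {N n : ℕ} (hN : n < N) (h : ℕ → ℝ) :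
    IsMultiplicative m β n (fun M => rootIdle m N M * h (degree M 0)) (-(m + β)) := by
  intro j M hM
  have h2 : ∀ i ∈ Finset.range (n + 1), ((degree M i : ℝ) + β) *
      (rootIdle m N ((n + 1, i) ::ₘ M) * h (degree ((n + 1, i) ::ₘ M) 0)) =
      ((degree M i : ℝ) + β) * (rootIdle m N M * h (degree M 0)) -
        if 0 = i then ((degree M i : ℝ) + β) * rootIdle m N M * h (degree M 0) else 0 := by
    intro i hi
    have hi' := Nat.lt_succ_iff.1 (Finset.mem_range.1 hi)
    rw [rootIdle_cons_of_lt hN hi' hM, degree_cons_old M (Nat.zero_le n)]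
    split_ifs with h0
    · subst h0
      simp only [sub_self, zero_mul, mul_zero]
      ring
    · simp
  rw [Finset.sum_congr rfl h2, Finset.sum_sub_distrib, ← Finset.sum_mul, hM.sum_weight,
    Finset.sum_ite_eq, if_pos (Finset.mem_range.2 (Nat.succ_pos n)), weight_mul_rootIdle hN hM]
  ring

/-! ### Positive and negative moments of the degree -/

/-- The rising factorial of the weight of a vertex of degree `d`. -/
def risingWeight (β : ℝ) (p d : ℕ) : ℝ := ∏ i ∈ Finset.range p, ((d : ℝ) + β + i)

theorem risingWeight_step (p d : ℕ) :
    ((d : ℝ) + β) * (risingWeight β p (d + 1) - risingWeight β p d) = p * risingWeight β p d := by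
  have h : ((d : ℝ) + β) * risingWeight β p (d + 1) = risingWeight β p d * (d + β + p) := by
    induction p with
    | zero => simp [risingWeight]
    | succ p ih =>
      rw [risingWeight, risingWeight, Finset.prod_range_succ, Finset.prod_range_succ,
        ← risingWeight, ← risingWeight, ← mul_assoc, ih]
      push_cast
      ring
  rw [mul_sub, h]
  ring

theorem risingWeight_nonneg (hβ : 0 ≤ β) (p d : ℕ) : 0 ≤ risingWeight β p d :=
  Finset.prod_nonneg fun i _ => by positivity

theorem exp_le_risingWeight {p d : ℕ} {l : ℝ} (h : Real.exp l ≤ d + β) :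
    Real.exp (p * l) ≤ risingWeight β p d := by
  rw [Real.exp_nat_mul, risingWeight]
  calc Real.exp l ^ p = ∏ _i ∈ Finset.range p, Real.exp l := by simp
    _ ≤ _ := Finset.prod_le_prod (fun _ _ => (Real.exp_pos l).le) fun i _ =>
      h.trans (le_add_of_nonneg_right (Nat.cast_nonneg i))

/-- Crude, from x ≤ e^x in each factor. The resulting e^(p²) leads to the choice of p of order
√(1+L) and to the subpolynomial factor of the upper bound. -/
theorem risingWeight_le (hβ : 0 ≤ β) (p d : ℕ) :
    risingWeight β p d ≤ Real.exp (p * (d + β + p)) := by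
  rw [Real.exp_nat_mul, risingWeight]
  calc _ ≤ ∏ _i ∈ Finset.range p, Real.exp (d + β + p) :=
      Finset.prod_le_prod (fun _ _ => by positivity) fun i hi => by
        have h1 : (i : ℝ) ≤ p := by exact_mod_cast (Finset.mem_range.1 hi).le
        have h2 := Real.add_one_le_exp ((d : ℝ) + β + p)
        linarith
    _ = _ := by simp

/-- A function of the degree that decays like the power `-q`. -/
def decay (m : ℕ) (β q : ℝ) (d : ℕ) : ℝ := ∏ i ∈ Finset.Ico m d, (1 - q / ((i : ℝ) + β))

theorem decay_step (hm : 1 ≤ m) (hβ : 0 ≤ β) (q : ℝ) (d : ℕ) (hd : m ≤ d) :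
    ((d : ℝ) + β) * (decay m β q (d + 1) - decay m β q d) = -q * decay m β q d := by
  have h1 : (1 : ℝ) ≤ d := by exact_mod_cast hm.trans hd
  have h2 : (d : ℝ) + β ≠ 0 := by positivity
  rw [decay, Finset.prod_Ico_succ_top hd, ← decay]
  field_simp
  ring

theorem decay_nonneg (hm : 1 ≤ m) (hβ : 0 ≤ β) {q : ℝ} (hq : q ≤ m + β) (d : ℕ) :
    0 ≤ decay m β q d := by
  refine Finset.prod_nonneg fun i hi => ?_
  have h1 : (m : ℝ) ≤ i := by exact_mod_cast (Finset.mem_Ico.1 hi).1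
  have h2 : (1 : ℝ) ≤ m := by exact_mod_cast hm
  rw [sub_nonneg, div_le_one (by linarith)]
  linarith

theorem decay_self (m : ℕ) (β q : ℝ) : decay m β q m = 1 := by simp [decay]

/-- The inverse of 1 − q/z is 1 + q/(z−q), to which 1 + x ≤ e^x applies. -/
theorem exp_neg_div_le_one_sub {q z : ℝ} (hqz : q < z) (hz : 0 < z) :
    Real.exp (-(q / (z - q))) ≤ 1 - q / z := by
  have h1 : 0 < z - q := sub_pos.2 hqz
  have h : q / (z - q) + 1 = z / (z - q) := by field_simp; ring
  have h2 : 1 - q / z = (q / (z - q) + 1)⁻¹ := by rw [h, inv_div, sub_div, div_self hz.ne']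
  have h3 : 0 < q / (z - q) + 1 := by
    rw [h]
    positivity
  rw [Real.exp_neg, h2]
  exact inv_anti₀ h3 (Real.add_one_le_exp _)

theorem sum_inv_le (N : ℕ) : ∑ j ∈ Finset.Ico 1 (N + 1), (1 : ℝ) / j ≤ 1 + Real.log N := by
  have h := harmonic_le_one_add_log N
  rw [harmonic_eq_sum_Icc] at h
  push_cast at h
  simpa [one_div, Finset.Ico_add_one_right_eq_Icc] using h

/-- Only the first factor 1 − q/(m+β) degenerates as q tends to m+β, so it is kept apart. For i > m
the difference i+β−q is at least i−m, and the other factors give a harmonic sum. This uniformity in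
q is needed because q is later taken close to m+β. -/
theorem le_decay (hm : 1 ≤ m) (hβ : 0 ≤ β) {q : ℝ} (hq0 : 0 ≤ q) (hq : q < m + β) {d : ℕ}
    (hd : m ≤ d) {l : ℝ} (hl : (d : ℝ) + β ≤ Real.exp l) :
    (m + β - q) / (m + β) * Real.exp (-(q * (1 + l))) ≤ decay m β q d := by
  have hm1 : (1 : ℝ) ≤ m := by exact_mod_cast hm
  have hb : 0 < (m : ℝ) + β := by positivity
  have hfac : (m + β - q) / (m + β) ≤ 1 := by rw [div_le_one hb]; linarith
  have hfac0 : 0 ≤ (m + β - q) / (m + β) := div_nonneg (by linarith) hb.le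
  have hl0 : 0 ≤ l := by
    have h1 : (m : ℝ) ≤ d := by exact_mod_cast hd
    by_contra! h
    have := Real.exp_lt_one_iff.2 h
    linarith
  rcases Nat.lt_or_eq_of_le hd with hd | rfl
  · rw [decay, Finset.prod_eq_prod_Ico_succ_bot hd]
    have h0 : (m + β - q) / (m + β) = 1 - q / (m + β) := by field_simp
    rw [h0] at hfac0 ⊢
    refine mul_le_mul_of_nonneg_left ?_ hfac0
    calc Real.exp (-(q * (1 + l)))
        ≤ Real.exp (∑ i ∈ Finset.Ico (m + 1) d, -(q * (1 / ((i - m : ℕ) : ℝ)))) := by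
          rw [Real.exp_le_exp, Finset.sum_neg_distrib, neg_le_neg_iff, ← Finset.mul_sum]
          refine mul_le_mul_of_nonneg_left ?_ hq0
          obtain ⟨J, rfl⟩ : ∃ J, d = m + 1 + J := ⟨d - (m + 1), by omega⟩
          have h3 : ∑ i ∈ Finset.Ico (m + 1) (m + 1 + J), (1 / ((i - m : ℕ) : ℝ)) =
              ∑ j ∈ Finset.Ico 1 (J + 1), (1 : ℝ) / j := by
            rw [show m + 1 = 1 + m by ring, show 1 + m + J = (J + 1) + m by ring,
              ← Finset.sum_Ico_add' (fun i : ℕ => 1 / ((i - m : ℕ) : ℝ)) 1 (J + 1) m]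
            simp
          rw [h3]
          refine (sum_inv_le J).trans ?_
          rcases Nat.eq_zero_or_pos J with rfl | hJ
          · simpa using hl0
          · have hJ' : (0 : ℝ) < J := by exact_mod_cast hJ
            have h4 : Real.log J ≤ l := by
              rw [← Real.log_exp l]
              refine Real.log_le_log hJ' (le_trans ?_ hl)
              push_cast
              linarith
            linarith
      _ = ∏ i ∈ Finset.Ico (m + 1) d, Real.exp (-(q * (1 / ((i - m : ℕ) : ℝ)))) :=
          Real.exp_sum _ _
      _ ≤ _ := by
          refine Finset.prod_le_prod (fun _ _ => (Real.exp_pos _).le) fun i hi => ?_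
          have hi' := (Finset.mem_Ico.1 hi).1
          have h5 : (m : ℝ) + 1 ≤ i := by exact_mod_cast hi'
          refine le_trans (Real.exp_le_exp.2 ?_)
            (exp_neg_div_le_one_sub (z := (i : ℝ) + β) (by linarith) (by linarith))
          rw [neg_le_neg_iff, Nat.cast_sub (by omega), div_eq_mul_one_div]
          exact mul_le_mul_of_nonneg_left
            (one_div_le_one_div_of_le (by linarith) (by linarith)) hq0
  · rw [decay_self]
    exact mul_le_one₀ hfac (Real.exp_pos _).le (Real.exp_le_one_iff.2 (by nlinarith))

/-! ### Growth rates -/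

/-- The growth exponent of the degrees. -/
def growthExponent (m : ℕ) (β : ℝ) : ℝ := m / (2 * m + β)

theorem growthExponent_pos (hm : 1 ≤ m) (hβ : 0 ≤ β) : 0 < growthExponent m β := by
  have h1 : (1 : ℝ) ≤ m := by exact_mod_cast hm
  unfold growthExponent
  positivity

theorem growthExponent_le_one (hm : 1 ≤ m) (hβ : 0 ≤ β) : growthExponent m β ≤ 1 := by
  have h1 : (1 : ℝ) ≤ m := by exact_mod_cast hm
  unfold growthExponent
  rw [div_le_one (by positivity)]
  linarith

theorem le_totalWeight (hβ : 0 ≤ β) (n j : ℕ) : (2 * m + β) * n ≤ totalWeight m β n j := by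
  unfold totalWeight
  have : (0 : ℝ) ≤ j := Nat.cast_nonneg j
  linarith

theorem totalWeight_le {j : ℕ} (hj : j < m) (n : ℕ) :
    totalWeight m β n j ≤ (2 * m + β) * (n + 1) := by
  unfold totalWeight
  have h1 : (j : ℝ) ≤ m := by exact_mod_cast hj.le
  have h2 : (0 : ℝ) ≤ m := Nat.cast_nonneg m
  linarith

theorem weight_le_totalWeight (hβ : 0 ≤ β) {n : ℕ} (hn : 1 ≤ n) (j : ℕ) :
    m + β ≤ totalWeight m β n j := by
  unfold totalWeight
  have h1 : (0 : ℝ) ≤ j := Nat.cast_nonneg j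
  have h2 : (1 : ℝ) ≤ n := by exact_mod_cast hn
  have h3 : (0 : ℝ) ≤ m := Nat.cast_nonneg m
  nlinarith

theorem one_add_neg_div_nonneg (hm : 1 ≤ m) (hβ : 0 ≤ β) {q : ℝ} (hq : q ≤ m + β) {n : ℕ}
    (hn : 1 ≤ n) (j : ℕ) : 0 ≤ 1 + -q / totalWeight m β n j := by
  have hW := totalWeight_pos hm hβ hn j
  rw [neg_div, ← sub_eq_add_neg, sub_nonneg, div_le_one hW]
  exact hq.trans (weight_le_totalWeight hβ hn j)

theorem prod_range_le_exp {n : ℕ} (F : ℕ → ℝ) {x y : ℝ} (h0 : ∀ j < n, 0 ≤ F j)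
    (h : ∀ j < n, F j ≤ Real.exp x) (hy : n * x = y) :
    ∏ j ∈ Finset.range n, F j ≤ Real.exp y := by
  rw [← hy, Real.exp_nat_mul]
  calc _ ≤ ∏ _j ∈ Finset.range n, Real.exp x :=
      Finset.prod_le_prod (fun j hj => h0 j (Finset.mem_range.1 hj))
        fun j hj => h j (Finset.mem_range.1 hj)
    _ = _ := by simp

theorem stepFactor_le_of_nonneg (hm : 1 ≤ m) (hβ : 0 ≤ β) {c : ℝ} (hc : 0 ≤ c) {n : ℕ}
    (hn : 1 ≤ n) : stepFactor m β c n ≤ Real.exp (c * growthExponent m β * (1 / n)) := by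
  have h1 : (1 : ℝ) ≤ m := by exact_mod_cast hm
  have h2 : (1 : ℝ) ≤ n := by exact_mod_cast hn
  refine prod_range_le_exp _ (x := c / ((2 * m + β) * n)) (fun j _ => ?_) (fun j _ => ?_) ?_
  · have hW := totalWeight_pos hm hβ hn j
    positivity
  · rw [add_comm]
    refine (Real.add_one_le_exp _).trans (Real.exp_le_exp.2 ?_)
    exact div_le_div_of_nonneg_left hc (by positivity) (le_totalWeight hβ n j)
  · unfold growthExponent
    field_simp

theorem stepFactor_neg_le (hm : 1 ≤ m) (hβ : 0 ≤ β) {q : ℝ} (hq0 : 0 ≤ q) (hq : q ≤ m + β)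
    {n : ℕ} (hn : 1 ≤ n) :
    stepFactor m β (-q) n ≤ Real.exp (-(q * growthExponent m β * (1 / (n + 1)))) := by
  have h1 : (1 : ℝ) ≤ m := by exact_mod_cast hm
  refine prod_range_le_exp _ (x := -(q / ((2 * m + β) * (n + 1))))
    (fun j _ => one_add_neg_div_nonneg hm hβ hq hn j) (fun j hj => ?_) ?_
  · rw [add_comm, neg_div]
    refine (Real.add_one_le_exp _).trans (Real.exp_le_exp.2 (neg_le_neg ?_))
    exact div_le_div_of_nonneg_left hq0 (totalWeight_pos hm hβ hn j) (totalWeight_le hj n)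
  · unfold growthExponent
    field_simp

/-- The shift 1/2 comes from `totalWeight` − (m+β) ≥ (2m+β)(n − 1/2), which keeps the bound finite
down to n = 1. -/
theorem le_stepFactor_neg (hm : 1 ≤ m) (hβ : 0 ≤ β) {n : ℕ} (hn : 1 ≤ n) :
    Real.exp (-((m + β) * growthExponent m β * (1 / (n - 1 / 2)))) ≤
      stepFactor m β (-(m + β)) n := by
  have h1 : (1 : ℝ) ≤ m := by exact_mod_cast hm
  have h2 : (1 : ℝ) ≤ n := by exact_mod_cast hn
  have hn2 : (0 : ℝ) < n - 1 / 2 := by linarith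
  have h3 : -((m + β) * growthExponent m β * (1 / (n - 1 / 2))) =
      m * -((m + β) / ((2 * m + β) * (n - 1 / 2))) := by
    unfold growthExponent
    field_simp
  rw [h3, Real.exp_nat_mul, stepFactor]
  calc _ = ∏ _j ∈ Finset.range m, Real.exp (-((m + β) / ((2 * m + β) * (n - 1 / 2)))) := by simp
    _ ≤ _ := ?_
  refine Finset.prod_le_prod (fun _ _ => (Real.exp_pos _).le) fun j _ => ?_
  have h0 : (0 : ℝ) ≤ j := Nat.cast_nonneg j
  have h5 : (2 * m + β) * (n - 1 / 2) ≤ totalWeight m β n j - (m + β) := by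
    unfold totalWeight
    nlinarith
  have h6 : 0 < (2 * m + β) * ((n : ℝ) - 1 / 2) := by positivity
  rw [neg_div, ← sub_eq_add_neg]
  refine le_trans (Real.exp_le_exp.2 (neg_le_neg ?_))
    (exp_neg_div_le_one_sub (by linarith) (totalWeight_pos hm hβ hn j))
  exact div_le_div_of_nonneg_left (by positivity) h6 h5

theorem sum_Ico_inv_le {k n : ℕ} (hk : 1 ≤ k) (hkn : k ≤ n) :
    ∑ t ∈ Finset.Ico k n, (1 : ℝ) / t ≤ Real.log n - Real.log k + (1 / k - 1 / n) := by
  induction n, hkn using Nat.le_induction with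
  | base => simp
  | succ n hkn ih =>
    rw [Finset.sum_Ico_succ_top hkn]
    have hn : (0 : ℝ) < n := by exact_mod_cast hk.trans hkn
    have h1 := Real.one_sub_inv_le_log_of_pos (x := ((n : ℝ) + 1) / n) (by positivity)
    rw [Real.log_div (by positivity) hn.ne'] at h1
    have h2 : 1 - (((n : ℝ) + 1) / n)⁻¹ = 1 / (n + 1) := by field_simp; ring
    push_cast
    linarith

theorem le_sum_Ico_inv {k n : ℕ} (hkn : k ≤ n) :
    Real.log (n + 1) - Real.log (k + 1) ≤ ∑ t ∈ Finset.Ico k n, (1 : ℝ) / (t + 1) := by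
  induction n, hkn using Nat.le_induction with
  | base => simp
  | succ n hkn ih =>
    rw [Finset.sum_Ico_succ_top hkn]
    have h1 := Real.log_le_sub_one_of_pos (x := ((n : ℝ) + 1 + 1) / (n + 1)) (by positivity)
    rw [Real.log_div (by positivity) (by positivity)] at h1
    have h2 : ((n : ℝ) + 1 + 1) / (n + 1) - 1 = 1 / (n + 1) := by field_simp; ring
    push_cast
    linarith

/-- The correction −3/n makes the induction telescope. -/
theorem sum_Ico_inv_sub_half_le {n : ℕ} (hn : 1 ≤ n) :
    ∑ t ∈ Finset.Ico 1 n, (1 : ℝ) / (t - 1 / 2) ≤ Real.log n + (3 - 3 / n) := by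
  induction n, hn using Nat.le_induction with
  | base => simp
  | succ n hn ih =>
    rw [Finset.sum_Ico_succ_top hn]
    have hn : (1 : ℝ) ≤ n := by exact_mod_cast hn
    have h1 := Real.one_sub_inv_le_log_of_pos (x := ((n : ℝ) + 1) / n) (by positivity)
    rw [Real.log_div (by positivity) (by positivity)] at h1
    have h2 : 1 - (((n : ℝ) + 1) / n)⁻¹ = 1 / (n + 1) := by field_simp; ring
    have h3 : (1 : ℝ) / (n - 1 / 2) ≤ 1 / (n + 1) + (3 / n - 3 / (n + 1)) := by
      have h4 : 1 / ((n : ℝ) + 1) + (3 / n - 3 / (n + 1)) = (n + 3) / (n * (n + 1)) := by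
        field_simp; ring
      rw [h4, div_le_div_iff₀ (by linarith) (by positivity)]
      nlinarith
    push_cast
    linarith

theorem prod_Ico_le_exp {k n : ℕ} (F G : ℕ → ℝ) {x : ℝ} (h0 : ∀ t, k ≤ t → 0 ≤ F t)
    (h : ∀ t, k ≤ t → F t ≤ Real.exp (G t)) (hx : ∑ t ∈ Finset.Ico k n, G t ≤ x) :
    ∏ t ∈ Finset.Ico k n, F t ≤ Real.exp x := by
  refine le_trans ?_ (Real.exp_le_exp.2 hx)
  rw [Real.exp_sum]
  exact Finset.prod_le_prod (fun t ht => h0 t (Finset.mem_Ico.1 ht).1)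
    fun t ht => h t (Finset.mem_Ico.1 ht).1

theorem prod_stepFactor_le_of_nonneg (hm : 1 ≤ m) (hβ : 0 ≤ β) {c : ℝ} (hc : 0 ≤ c) {k n : ℕ}
    (hk : 1 ≤ k) (hkn : k ≤ n) :
    ∏ t ∈ Finset.Ico k n, stepFactor m β c t ≤
      Real.exp (c * growthExponent m β * (Real.log n - Real.log k + 1)) := by
  have ha := growthExponent_pos hm hβ
  refine prod_Ico_le_exp _ (fun t => c * growthExponent m β * (1 / t)) (fun t ht => ?_)
    (fun t ht => stepFactor_le_of_nonneg hm hβ hc (hk.trans ht)) ?_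
  · refine Finset.prod_nonneg fun j _ => ?_
    have := totalWeight_pos hm hβ (hk.trans ht) j
    positivity
  · rw [← Finset.mul_sum]
    refine mul_le_mul_of_nonneg_left ((sum_Ico_inv_le hk hkn).trans ?_) (by positivity)
    have h1 : (1 : ℝ) / k ≤ 1 := by
      rw [div_le_one (by exact_mod_cast hk)]
      exact_mod_cast hk
    have h2 : (0 : ℝ) ≤ 1 / n := by positivity
    linarith

theorem prod_stepFactor_neg_le (hm : 1 ≤ m) (hβ : 0 ≤ β) {q : ℝ} (hq0 : 0 ≤ q) (hq : q ≤ m + β)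
    {k n : ℕ} (hk : 1 ≤ k) (hkn : k ≤ n) :
    ∏ t ∈ Finset.Ico k n, stepFactor m β (-q) t ≤
      Real.exp (-(q * growthExponent m β * (Real.log (n + 1) - Real.log (k + 1)))) := by
  have ha := growthExponent_pos hm hβ
  refine prod_Ico_le_exp _ (fun t => -(q * growthExponent m β * (1 / (t + 1)))) (fun t ht => ?_)
    (fun t ht => stepFactor_neg_le hm hβ hq0 hq (hk.trans ht)) ?_
  · exact Finset.prod_nonneg fun j _ => one_add_neg_div_nonneg hm hβ hq (hk.trans ht) j
  · rw [Finset.sum_neg_distrib, ← Finset.mul_sum, neg_le_neg_iff]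
    exact mul_le_mul_of_nonneg_left (le_sum_Ico_inv hkn) (by positivity)

/-- The probability that the root is not chosen by any of the vertices `2, …, N`. -/
def idleProb (m : ℕ) (β : ℝ) (N : ℕ) : ℝ := ∏ t ∈ Finset.Ico 1 N, stepFactor m β (-(m + β)) t

theorem exp_le_idleProb (hm : 1 ≤ m) (hβ : 0 ≤ β) {N : ℕ} (hN : 1 ≤ N) :
    Real.exp (-((m + β) * growthExponent m β * (Real.log N + 3))) ≤ idleProb m β N := by
  have ha := growthExponent_pos hm hβ
  calc _ ≤ Real.exp (∑ t ∈ Finset.Ico 1 N,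
        -((m + β) * growthExponent m β * (1 / ((t : ℝ) - 1 / 2)))) := by
        rw [Real.exp_le_exp, Finset.sum_neg_distrib, ← Finset.mul_sum, neg_le_neg_iff]
        refine mul_le_mul_of_nonneg_left ((sum_Ico_inv_sub_half_le hN).trans ?_) (by positivity)
        have : (0 : ℝ) ≤ 3 / N := by positivity
        linarith
    _ ≤ _ := by
        rw [Real.exp_sum, idleProb]
        exact Finset.prod_le_prod (fun _ _ => (Real.exp_pos _).le)
          fun t ht => le_stepFactor_neg hm hβ (Finset.mem_Ico.1 ht).1

/-! ### Tail estimates for the degrees -/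

theorem stepFactor_nonneg {c : ℝ} {n : ℕ} (h : ∀ j, 0 ≤ 1 + c / totalWeight m β n j) :
    0 ≤ stepFactor m β c n :=
  Finset.prod_nonneg fun j _ => h j

theorem one_add_div_nonneg (hm : 1 ≤ m) (hβ : 0 ≤ β) {c : ℝ} (hc : 0 ≤ c) {n : ℕ} (hn : 1 ≤ n)
    (j : ℕ) : 0 ≤ 1 + c / totalWeight m β n j := by
  have := totalWeight_pos hm hβ hn j
  positivity

/-- Markov's inequality for the decreasing functional `decay` of the root, started at time 1, where
the root has degree m and the functional equals 1. -/
theorem prob_root_le (hm : 1 ≤ m) (hβ : 0 ≤ β) (hf : ∀ i : ℕ, 1 ≤ i → (f i : ℝ) = i + β)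
    {n : ℕ} (hn : 1 ≤ n) {q : ℝ} (hq0 : 0 ≤ q) (hq : q < m + β) (l : ℝ) :
    (graphLaw f m n).toOuterMeasure {G | (degree (labels G) 0 : ℝ) + β ≤ Real.exp l} ≤
      ENNReal.ofReal ((m + β) / (m + β - q) * Real.exp (q * (1 + l) -
        q * growthExponent m β * (Real.log (n + 1) - Real.log 2))) := by
  have hm1 : (1 : ℝ) ≤ m := by exact_mod_cast hm
  have hb : 0 < (m : ℝ) + β := by positivity
  have hbq : 0 < (m : ℝ) + β - q := by linarith
  have hE := expect_graphLaw (m := m) (f := f) hm hβ hf le_rfl hn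
    (Φ := fun M => decay m β q (degree M 0)) (fun M => decay_nonneg hm hβ hq.le _) (fun _ => -q)
    (fun t ht _ => isMultiplicative_degree (Nat.zero_le t) (decay_step hm hβ q))
    (fun t ht _ => one_add_neg_div_nonneg hm hβ hq.le ht) zero_le_one
    (expect_graphLaw_eq_of_forall (n := 0) (Φ := fun M => decay m β q (degree M 0))
      fun M hM => by rw [hM.degree_root, decay_self])
  refine toOuterMeasure_le_of_expect _ _ (fun G => decay m β q (degree (labels G) 0))
    (y := (m + β - q) / (m + β) * Real.exp (-(q * (1 + l)))) (by positivity) (fun G hG hGl => ?_)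
    hE.le ?_
  · obtain ⟨n, rfl⟩ : ∃ k, n = k + 1 := ⟨n - 1, by omega⟩
    exact le_decay hm hβ hq0 hq
      ((attaching_graphLaw f m n G hG).le_degree 0 (Nat.zero_le _)) hGl
  · have h1 := prod_stepFactor_neg_le hm hβ hq0 hq.le le_rfl hn
    rw [one_mul]
    refine h1.trans (le_of_eq ?_)
    have h2 : ∀ x y : ℝ, (m + β) / (m + β - q) * x * ((m + β - q) / (m + β) * y) = x * y := by
      intro x y
      field_simp
    rw [h2, ← Real.exp_add]
    congr 1
    push_cast
    norm_num
    ring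

/-- Markov's inequality for the rising factorial of order p, started at time k, when the vertex k
has degree exactly m. -/
theorem prob_vertex_ge (hm : 1 ≤ m) (hβ : 0 ≤ β) (hf : ∀ i : ℕ, 1 ≤ i → (f i : ℝ) = i + β)
    {k n : ℕ} (hk : 1 ≤ k) (hkn : k ≤ n) (p : ℕ) (l : ℝ) :
    (graphLaw f m n).toOuterMeasure {G | Real.exp l ≤ (degree (labels G) k : ℝ) + β} ≤
      ENNReal.ofReal (Real.exp (p * (m + β + p) +
        p * growthExponent m β * (Real.log n - Real.log k + 1) - p * l)) := by
  obtain ⟨k, rfl⟩ : ∃ i, k = i + 1 := ⟨k - 1, by omega⟩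
  have hE := expect_graphLaw (m := m) (f := f) hm hβ hf hk hkn
    (Φ := fun M => risingWeight β p (degree M (k + 1))) (fun M => risingWeight_nonneg hβ p _)
    (fun _ => p) (fun t ht _ => isMultiplicative_degree ht fun d _ => risingWeight_step p d)
    (fun t ht _ => one_add_div_nonneg hm hβ (Nat.cast_nonneg p) (hk.trans ht))
    (risingWeight_nonneg hβ p m)
    (expect_graphLaw_eq_of_forall (Φ := fun M => risingWeight β p (degree M (k + 1)))
      fun M hM => by rw [hM.degree_new])
  refine toOuterMeasure_le_of_expect _ _ (fun G => risingWeight β p (degree (labels G) (k + 1)))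
    (Real.exp_pos (p * l)) (fun G _ hGl => exp_le_risingWeight hGl) hE.le ?_
  have h1 := prod_stepFactor_le_of_nonneg hm hβ (Nat.cast_nonneg p) hk hkn
  refine (mul_le_mul (risingWeight_le hβ p m) h1
    (Finset.prod_nonneg fun t ht => stepFactor_nonneg (one_add_div_nonneg hm hβ
      (Nat.cast_nonneg p) (hk.trans (Finset.mem_Ico.1 ht).1))) (Real.exp_pos _).le).trans
    (le_of_eq ?_)
  rw [← Real.exp_add, ← Real.exp_add]
  congr 1
  ring

/-! ### Estimates on the event that the root is idle for a long time -/

theorem expect_rootIdle_of_le (hm : 1 ≤ m) (hβ : 0 ≤ β)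
    (hf : ∀ i : ℕ, 1 ≤ i → (f i : ℝ) = i + β) {N n : ℕ} (hn : 1 ≤ n) (hnN : n ≤ N)
    {h : ℕ → ℝ} (hh : ∀ d, 0 ≤ h d) :
    expect (graphLaw f m n) (fun G =>
        ENNReal.ofReal (rootIdle m N (labels G) * h (degree (labels G) 0))) =
      ENNReal.ofReal (h m * idleProb m β n) := by
  refine expect_graphLaw (m := m) (f := f) hm hβ hf le_rfl hn
    (Φ := fun M => rootIdle m N M * h (degree M 0))
    (fun M => mul_nonneg (rootIdle_nonneg m N M) (hh _)) (fun _ => -(m + β))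
    (fun t _ ht => isMultiplicative_rootIdle_root (ht.trans_le hnN) h)
    (fun t ht _ => one_add_neg_div_nonneg hm hβ le_rfl ht) (hh m) ?_
  refine expect_graphLaw_eq_of_forall (n := 0)
    (Φ := fun M => rootIdle m N M * h (degree M 0)) fun M hM => ?_
  rw [rootIdle_eq (hn.trans hnN) hM, hM.degree_root, if_pos rfl, one_mul]

theorem idleProb_nonneg (hm : 1 ≤ m) (hβ : 0 ≤ β) (N : ℕ) : 0 ≤ idleProb m β N :=
  Finset.prod_nonneg fun _ ht =>
    stepFactor_nonneg (one_add_neg_div_nonneg hm hβ le_rfl (Finset.mem_Ico.1 ht).1)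

theorem expect_rootIdle_mul_root (hm : 1 ≤ m) (hβ : 0 ≤ β)
    (hf : ∀ i : ℕ, 1 ≤ i → (f i : ℝ) = i + β) {N n : ℕ} (hN : 1 ≤ N) (hNn : N ≤ n)
    {h : ℕ → ℝ} (hh : ∀ d, 0 ≤ h d) {c : ℝ} (hc : 0 ≤ c)
    (hstep : ∀ d, m ≤ d → ((d : ℝ) + β) * (h (d + 1) - h d) = c * h d) :
    expect (graphLaw f m n) (fun G =>
        ENNReal.ofReal (rootIdle m N (labels G) * h (degree (labels G) 0))) =
      ENNReal.ofReal (h m * idleProb m β N * ∏ t ∈ Finset.Ico N n, stepFactor m β c t) :=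
  expect_graphLaw (m := m) (f := f) hm hβ hf hN hNn
    (Φ := fun M => rootIdle m N M * h (degree M 0))
    (fun M => mul_nonneg (rootIdle_nonneg m N M) (hh _)) (fun _ => c)
    (fun _ ht _ => isMultiplicative_rootIdle_of_le ht (Nat.zero_le _) hstep)
    (fun _ ht _ => one_add_div_nonneg hm hβ hc (hN.trans ht))
    (mul_nonneg (hh m) (idleProb_nonneg hm hβ N))
    (expect_rootIdle_of_le hm hβ hf hN le_rfl hh)

theorem expect_rootIdle (hm : 1 ≤ m) (hβ : 0 ≤ β)
    (hf : ∀ i : ℕ, 1 ≤ i → (f i : ℝ) = i + β) {N n : ℕ} (hN : 1 ≤ N) (hNn : N ≤ n) :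
    expect (graphLaw f m n) (fun G => ENNReal.ofReal (rootIdle m N (labels G))) =
      ENNReal.ofReal (idleProb m β N) := by
  have h := expect_rootIdle_mul_root (m := m) (f := f) hm hβ hf hN hNn (h := fun _ => 1)
    (fun _ => zero_le_one) le_rfl (fun d _ => by simp)
  simpa [stepFactor] using h

theorem two_mul_weight_le_totalWeight (hβ : 0 ≤ β) {n : ℕ} (hn : 1 ≤ n) (j : ℕ) :
    2 * (m + β) ≤ totalWeight m β n j := by
  unfold totalWeight
  have h1 : (0 : ℝ) ≤ j := Nat.cast_nonneg j
  have h2 : (1 : ℝ) ≤ n := by exact_mod_cast hn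
  have h3 : (0 : ℝ) ≤ m := Nat.cast_nonneg m
  nlinarith

theorem one_add_neg_sub_div_nonneg (hm : 1 ≤ m) (hβ : 0 ≤ β) {q : ℝ} (hq : q ≤ m + β)
    {n : ℕ} (hn : 1 ≤ n) (j : ℕ) : 0 ≤ 1 + (-q - (m + β)) / totalWeight m β n j := by
  have hW := totalWeight_pos hm hβ hn j
  have h2 := two_mul_weight_le_totalWeight (m := m) hβ hn j
  have h3 : 1 + (-q - (m + β)) / totalWeight m β n j =
      (totalWeight m β n j - q - (m + β)) / totalWeight m β n j := by field_simp; ring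
  rw [h3]
  exact div_nonneg (by linarith) hW.le

/-- Since 1 − x − y ≤ (1−x)(1−y) for x, y ≥ 0, idleness of the root and a small degree of another
vertex are negatively correlated: edges refused to the root go elsewhere. -/
theorem stepFactor_neg_sub_le (hm : 1 ≤ m) (hβ : 0 ≤ β) {q : ℝ} (hq0 : 0 ≤ q) (hq : q ≤ m + β)
    {n : ℕ} (hn : 1 ≤ n) :
    stepFactor m β (-q - (m + β)) n ≤ stepFactor m β (-(m + β)) n * stepFactor m β (-q) n := by
  rw [stepFactor, stepFactor, stepFactor, ← Finset.prod_mul_distrib]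
  refine Finset.prod_le_prod (fun j _ => one_add_neg_sub_div_nonneg hm hβ hq hn j) fun j _ => ?_
  have hW := totalWeight_pos hm hβ hn j
  have h1 : (1 + -(m + β) / totalWeight m β n j) * (1 + -q / totalWeight m β n j) =
      1 + (-q - (m + β)) / totalWeight m β n j +
        (m + β) / totalWeight m β n j * (q / totalWeight m β n j) := by ring
  rw [h1]
  have : 0 ≤ (m + β) / totalWeight m β n j * (q / totalWeight m β n j) := by positivity
  linarith

/-- Up to time k only the idleness costs; between k and N both effects act and are decoupled by
`stepFactor_neg_sub_le`; after N only the decay remains. -/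
theorem expect_rootIdle_mul_decay_le (hm : 1 ≤ m) (hβ : 0 ≤ β)
    (hf : ∀ i : ℕ, 1 ≤ i → (f i : ℝ) = i + β) {k N n : ℕ} (hk : 1 ≤ k) (hkN : k ≤ N) (hNn : N ≤ n)
    {q : ℝ} (hq0 : 0 ≤ q) (hq : q ≤ m + β) :
    expect (graphLaw f m n) (fun G =>
        ENNReal.ofReal (rootIdle m N (labels G) * decay m β q (degree (labels G) k))) ≤
      ENNReal.ofReal (idleProb m β N * Real.exp (-(q * growthExponent m β *
        (Real.log (n + 1) - Real.log (k + 1))))) := by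
  have hΦ : ∀ M, 0 ≤ rootIdle m N M * decay m β q (degree M k) := fun M =>
    mul_nonneg (rootIdle_nonneg m N M) (decay_nonneg hm hβ hq _)
  have h0 : expect (graphLaw f m k) (fun G =>
      ENNReal.ofReal (rootIdle m N (labels G) * decay m β q (degree (labels G) k))) =
      ENNReal.ofReal (idleProb m β k) := by
    have h := expect_rootIdle_of_le (m := m) (f := f) hm hβ hf hk hkN (h := fun _ => 1)
      (fun _ => zero_le_one)
    rw [one_mul] at h
    rw [← h]
    refine expect_congr fun G hG => ?_
    obtain ⟨k, rfl⟩ : ∃ i, k = i + 1 := ⟨k - 1, by omega⟩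
    rw [(attaching_graphLaw f m k G hG).degree_new, decay_self]
  have hnn : ∀ t, k ≤ t → 0 ≤ stepFactor m β (-q - (m + β)) t := fun t ht =>
    stepFactor_nonneg (one_add_neg_sub_div_nonneg hm hβ hq (hk.trans ht))
  have h1 := expect_graphLaw (m := m) (f := f) hm hβ hf hk hkN hΦ (fun _ => -q - (m + β))
    (fun t ht htN => isMultiplicative_rootIdle_of_lt htN ht hk (decay_step hm hβ q))
    (fun t ht _ => one_add_neg_sub_div_nonneg hm hβ hq (hk.trans ht))
    (idleProb_nonneg hm hβ k) h0
  have h2 := expect_graphLaw (m := m) (f := f) hm hβ hf (hk.trans hkN) hNn hΦ (fun _ => -q)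
    (fun t ht htN => isMultiplicative_rootIdle_of_le ht (hkN.trans ht) (decay_step hm hβ q))
    (fun t ht _ => one_add_neg_div_nonneg hm hβ hq ((hk.trans hkN).trans ht))
    (mul_nonneg (idleProb_nonneg hm hβ k)
      (Finset.prod_nonneg fun t ht => hnn t (Finset.mem_Ico.1 ht).1)) h1
  rw [h2]
  refine ENNReal.ofReal_le_ofReal ?_
  have hq' : ∀ t, k ≤ t → 0 ≤ stepFactor m β (-q) t := fun t ht =>
    stepFactor_nonneg (one_add_neg_div_nonneg hm hβ hq (hk.trans ht))
  have h3 : ∏ t ∈ Finset.Ico k N, stepFactor m β (-q - (m + β)) t ≤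
      (∏ t ∈ Finset.Ico k N, stepFactor m β (-(m + β)) t) *
        ∏ t ∈ Finset.Ico k N, stepFactor m β (-q) t := by
    rw [← Finset.prod_mul_distrib]
    exact Finset.prod_le_prod (fun t ht => hnn t (Finset.mem_Ico.1 ht).1) fun t ht =>
      stepFactor_neg_sub_le hm hβ hq0 hq (hk.trans (Finset.mem_Ico.1 ht).1)
  calc _ ≤ idleProb m β k * ((∏ t ∈ Finset.Ico k N, stepFactor m β (-(m + β)) t) *
        ∏ t ∈ Finset.Ico k N, stepFactor m β (-q) t) *
          ∏ t ∈ Finset.Ico N n, stepFactor m β (-q) t :=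
        mul_le_mul_of_nonneg_right
          (mul_le_mul_of_nonneg_left h3 (idleProb_nonneg hm hβ k))
          (Finset.prod_nonneg fun t ht => hq' t (hkN.trans (Finset.mem_Ico.1 ht).1))
    _ = idleProb m β N * ∏ t ∈ Finset.Ico k n, stepFactor m β (-q) t := by
        rw [idleProb, idleProb, ← Finset.prod_Ico_consecutive _ hk hkN,
          ← Finset.prod_Ico_consecutive _ hkN hNn]
        ring
    _ ≤ _ := mul_le_mul_of_nonneg_left
        (prod_stepFactor_neg_le hm hβ hq0 hq hk (hkN.trans hNn)) (idleProb_nonneg hm hβ N)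

/-! ### Degree selections -/

/-- Pigeonhole: without the root, only K − 1 labels are available below K, so one of the K selected
vertices has label at least K. -/
theorem IsDegreeSelection.exists_of_notMem {H : Selection} (hH : IsDegreeSelection H) {K n : ℕ}
    (hK : 1 ≤ K) {G : MultiDigraph (Fin (n + 1))} (h0 : (0 : Fin (n + 1)) ∉ H K n G) :
    ∃ k, K ≤ k ∧ k ≤ n ∧ degree (labels G) 0 ≤ degree (labels G) k := by
  obtain ⟨hcard, hmax⟩ := hH K n G hK
  rw [Fintype.card_fin] at hcard
  have hlt : (H K n G).card < n + 1 := by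
    have h1 := Finset.card_lt_univ_of_notMem h0
    rwa [Fintype.card_fin] at h1
  have hcardK : (H K n G).card = K := by omega
  obtain ⟨v, hv, hvK⟩ : ∃ v ∈ H K n G, K ≤ v.val := by
    by_contra! hcon
    have h2 : (H K n G).image Fin.val ⊆ Finset.Ico 1 K := by
      intro x hx
      obtain ⟨v, hv, rfl⟩ := Finset.mem_image.1 hx
      refine Finset.mem_Ico.2 ⟨?_, hcon v hv⟩
      rw [Nat.one_le_iff_ne_zero]
      intro hv0
      have hv1 : v = 0 := Fin.ext hv0
      exact h0 (hv1 ▸ hv)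
    have h3 := Finset.card_le_card h2
    rw [Finset.card_image_of_injective _ Fin.val_injective, Nat.card_Ico, hcardK] at h3
    omega
  refine ⟨v.val, hvK, Nat.lt_succ_iff.1 v.isLt, ?_⟩
  have h4 : (degree G 0 : ℝ) ≤ degree G v := hmax v hv 0 h0
  rw [degree_labels, show (0 : ℕ) = (0 : Fin (n + 1)).val from rfl, degree_labels]
  exact_mod_cast h4

/-- A selected root would force every vertex of T to be selected as well, which makes at least K + 1
vertices. -/
theorem IsDegreeSelection.notMem_of_card {H : Selection} (hH : IsDegreeSelection H) {K n : ℕ}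
    (hK : 1 ≤ K) {G : MultiDigraph (Fin (n + 1))} (T : Finset ℕ) (hT : K ≤ T.card)
    (h : ∀ k ∈ T, k ≤ n ∧ degree (labels G) 0 < degree (labels G) k) :
    (0 : Fin (n + 1)) ∉ H K n G := by
  intro h0
  obtain ⟨hcard, hmax⟩ := hH K n G hK
  have h1 : insert 0 T ⊆ (H K n G).image Fin.val := by
    intro x hx
    rcases Finset.mem_insert.1 hx with rfl | hx
    · exact Finset.mem_image.2 ⟨0, h0, rfl⟩
    · obtain ⟨hxn, hdeg⟩ := h x hx
      refine Finset.mem_image.2 ⟨⟨x, Nat.lt_succ_of_le hxn⟩, ?_, rfl⟩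
      by_contra hmem
      have h2 := hmax 0 h0 _ hmem
      rw [Nat.cast_le, ← degree_labels, ← degree_labels] at h2
      exact absurd h2 (not_le.2 hdeg)
  have h2 := Finset.card_le_card h1
  rw [Finset.card_image_of_injective _ Fin.val_injective, Finset.card_insert_of_notMem
    fun hmem => lt_irrefl _ (h 0 hmem).2] at h2
  omega

/-! ### The probability of missing the root -/

theorem prob_notMem_le (hm : 1 ≤ m) (hβ : 0 ≤ β) (hf : ∀ i : ℕ, 1 ≤ i → (f i : ℝ) = i + β)
    {H : Selection} (hH : IsDegreeSelection H) {K n : ℕ} (hK : 1 ≤ K) (hn : 1 ≤ n) {q : ℝ}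
    (hq0 : 0 ≤ q) (hq : q < m + β) (p : ℕ) (D : ℝ) :
    (graphLaw f m n).toOuterMeasure {G | (0 : Fin (n + 1)) ∉ H K n G} ≤
      ENNReal.ofReal ((m + β) / (m + β - q) * Real.exp (q * (2 - D)) +
        ∑ k ∈ Finset.Icc K n,
          Real.exp (p * (m + β + p + 1 + D) - p * growthExponent m β * Real.log k)) := by
  have ha := growthExponent_pos hm hβ
  have ha1 := growthExponent_le_one hm hβ
  set a := growthExponent m β
  -- The common threshold e^l = e^(−D) n^a separates the root from its late competitors.
  set l : ℝ := -D + a * Real.log n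
  have hm1 : (1 : ℝ) ≤ m := by exact_mod_cast hm
  have hn1 : (1 : ℝ) ≤ n := by exact_mod_cast hn
  have hbq : 0 < (m : ℝ) + β - q := by linarith
  have hsub : {G | (0 : Fin (n + 1)) ∉ H K n G} ⊆
      {G | (degree (labels G) 0 : ℝ) + β ≤ Real.exp l} ∪
        ⋃ k ∈ Finset.Icc K n, {G | Real.exp l ≤ (degree (labels G) k : ℝ) + β} := by
    intro G hG
    obtain ⟨k, hKk, hkn, hdeg⟩ := hH.exists_of_notMem hK hG
    rcases le_total ((degree (labels G) 0 : ℝ) + β) (Real.exp l) with h | h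
    · exact Or.inl h
    · refine Or.inr (Set.mem_iUnion₂.2 ⟨k, Finset.mem_Icc.2 ⟨hKk, hkn⟩, h.trans ?_⟩)
      have : (degree (labels G) 0 : ℝ) ≤ degree (labels G) k := by exact_mod_cast hdeg
      linarith
  rw [ENNReal.ofReal_add (by positivity) (Finset.sum_nonneg fun _ _ => (Real.exp_pos _).le),
    ENNReal.ofReal_sum_of_nonneg fun _ _ => (Real.exp_pos _).le]
  refine (MeasureTheory.measure_mono hsub).trans ((MeasureTheory.measure_union_le _ _).trans
    (add_le_add ?_ ((MeasureTheory.measure_biUnion_finset_le _ _).trans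
      (Finset.sum_le_sum fun k hk => ?_))))
  · refine (prob_root_le hm hβ hf hn hq0 hq l).trans (ENNReal.ofReal_le_ofReal ?_)
    refine mul_le_mul_of_nonneg_left (Real.exp_le_exp.2 ?_) (by positivity)
    have h1 : Real.log n ≤ Real.log (n + 1) := Real.log_le_log (by linarith) (by linarith)
    have h2 : Real.log 2 ≤ 1 := by linarith [Real.log_two_lt_d9]
    have h3 : a * Real.log n - a * (Real.log (n + 1) - Real.log 2) ≤ 1 := by
      have h4 : a * Real.log n ≤ a * Real.log (n + 1) := mul_le_mul_of_nonneg_left h1 ha.le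
      have h5 : a * Real.log 2 ≤ 1 := by
        have := Real.log_pos one_lt_two
        nlinarith
      linarith
    have h6 := mul_le_mul_of_nonneg_left h3 hq0
    have h7 : q * (1 + l) = q * (1 - D) + q * (a * Real.log n) := by
      simp only [l]
      ring
    rw [h7]
    linarith
  · rw [Finset.mem_Icc] at hk
    refine (prob_vertex_ge hm hβ hf (hK.trans hk.1) hk.2 p l).trans
      (ENNReal.ofReal_le_ofReal (Real.exp_le_exp.2 ?_))
    have h1 : (p : ℝ) * a ≤ p * 1 := mul_le_mul_of_nonneg_left ha1 (Nat.cast_nonneg p)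
    simp only [l]
    linarith

theorem le_prob_notMem (hm : 1 ≤ m) (hβ : 0 ≤ β) :
    ∃ c : ℝ, 0 < c ∧ ∀ f : ℕ → Set.Ioi (0 : ℝ), (∀ i : ℕ, 1 ≤ i → (f i : ℝ) = i + β) →
      ∀ H : Selection, IsDegreeSelection H → ∀ K : ℕ, 1 ≤ K →
        ∀ᶠ n in atTop, ENNReal.ofReal
            (c * Real.exp (-((m + β) * growthExponent m β * Real.log K))) ≤
          (graphLaw f m n).toOuterMeasure {G | (0 : Fin (n + 1)) ∉ H K n G} := by
  have ha := growthExponent_pos hm hβ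
  set a := growthExponent m β with ha_def
  have hm1 : (1 : ℝ) ≤ m := by exact_mod_cast hm
  set b : ℝ := m + β with hb_def
  have hb : 0 < b := by positivity
  -- Chosen so that q(κ − 1) = log 16 for q = b/2; the 16 makes the second bad event cost at most a
  -- quarter of the idle event.
  set κ : ℝ := 1 + 2 / b * Real.log 16 with hκ_def
  -- Large enough that the mean weight of the root on the idle event is at most e^l/4 times the idle
  -- probability; the summand 2 ensures 2K ≤ N.
  set M : ℕ := ⌈Real.exp ((a * Real.log 3 + a + κ + Real.log (4 * b)) / a)⌉₊ + 2
  have hM0 : (0 : ℝ) < M := by positivity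
  have hM : a * Real.log 3 + a + κ + Real.log (4 * b) ≤ a * Real.log M := by
    have h1 : (a * Real.log 3 + a + κ + Real.log (4 * b)) / a ≤ Real.log M := by
      rw [Real.le_log_iff_exp_le hM0]
      refine (Nat.le_ceil _).trans ?_
      simp only [M]
      push_cast
      linarith
    rwa [div_le_iff₀' ha] at h1
  refine ⟨1 / 2 * Real.exp (-(b * a * (Real.log M + 3))), by positivity, ?_⟩
  intro f hf H hH K hK
  have hK1 : (1 : ℝ) ≤ K := by exact_mod_cast hK
  set N : ℕ := M * K
  have hKN : 2 * K ≤ N := Nat.mul_le_mul_right K (Nat.le_add_left 2 _)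
  have hN : 1 ≤ N := by omega
  filter_upwards [eventually_ge_atTop N] with n hn
  set P := graphLaw f m n
  set I := idleProb m β N
  have hI0 : 0 ≤ I := idleProb_nonneg hm hβ N
  set l : ℝ := -κ + a * (Real.log (n + 1) - Real.log (2 * K + 1)) with hl_def
  -- The two bad events inside the idle event: the root is nevertheless large, or at least K of the
  -- vertices 1, …, 2K are small.
  set S₀ : Set (MultiDigraph (Fin (n + 1))) :=
    {G | rootIdle m N (labels G) = 1 ∧ Real.exp l ≤ (degree (labels G) 0 : ℝ) + β}
  set S₁ : Set (MultiDigraph (Fin (n + 1))) :=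
    {G | rootIdle m N (labels G) = 1 ∧ K ≤ ((Finset.Icc 1 (2 * K)).filter fun k =>
      (degree (labels G) k : ℝ) + β ≤ Real.exp l).card}
  have hA : ENNReal.ofReal I ≤ P.toOuterMeasure {G | rootIdle m N (labels G) = 1} := by
    classical
    rw [toOuterMeasure_eq_expect, ← expect_rootIdle hm hβ hf hN hn]
    refine le_of_eq (expect_congr fun G _ => ?_)
    congr 1
    simp only [Set.mem_ofPred_eq, rootIdle]
    split_ifs <;> simp_all
  have h0 : P.toOuterMeasure S₀ ≤ ENNReal.ofReal (I / 4) := by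
    have hE := expect_rootIdle_mul_root (f := f) hm hβ hf hN hn (h := fun d => (d : ℝ) + β)
      (fun d => by positivity) zero_le_one (fun d _ => by push_cast; ring)
    refine toOuterMeasure_le_of_expect P S₀
      (fun G => rootIdle m N (labels G) * (degree (labels G) 0 + β)) (Real.exp_pos l)
      (fun G _ hG => by rw [hG.1, one_mul]; exact hG.2) hE.le ?_
    have h1 := prod_stepFactor_le_of_nonneg hm hβ zero_le_one hN hn
    rw [one_mul, ← ha_def] at h1
    have h2 : Real.exp (a * (Real.log n - Real.log N + 1)) ≤ Real.exp l / (4 * b) := by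
      rw [le_div_iff₀ (by positivity), ← Real.exp_log (show 0 < 4 * b by positivity),
        ← Real.exp_add, Real.exp_le_exp]
      have h3 : Real.log N = Real.log M + Real.log K := by
        simp only [N]
        rw [Nat.cast_mul, Real.log_mul hM0.ne' (by positivity)]
      have h4 : Real.log (2 * K + 1) ≤ Real.log 3 + Real.log K := by
        rw [← Real.log_mul (by norm_num) (by positivity)]
        exact Real.log_le_log (by positivity) (by linarith)
      have h5 : Real.log n ≤ Real.log (n + 1) := by
        have : (0 : ℝ) < n := by exact_mod_cast hN.trans hn
        exact Real.log_le_log this (by linarith)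
      have h6 := mul_le_mul_of_nonneg_left h4 ha.le
      have h7 := mul_le_mul_of_nonneg_left h5 ha.le
      rw [hl_def, h3]
      linarith
    calc _ ≤ b * I * (Real.exp l / (4 * b)) :=
          mul_le_mul_of_nonneg_left (h1.trans h2) (by positivity)
      _ = _ := by field_simp
  have h1 : P.toOuterMeasure S₁ ≤ ENNReal.ofReal (I / 4) := by
    set q : ℝ := b / 2 with hq_def
    have hqb : q < b := by linarith
    have hq0 : 0 ≤ q := by positivity
    set F : ℕ → MultiDigraph (Fin (n + 1)) → ℝ := fun k G =>
      rootIdle m N (labels G) * decay m β q (degree (labels G) k)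
    have hF : ∀ k G, 0 ≤ F k G := fun k G =>
      mul_nonneg (rootIdle_nonneg m N _) (decay_nonneg hm hβ hqb.le _)
    set E := Real.exp (-(q * a * (Real.log (n + 1) - Real.log (2 * K + 1))))
    have hE : expect P (fun G => ENNReal.ofReal (∑ k ∈ Finset.Icc 1 (2 * K), F k G)) ≤
        ENNReal.ofReal (2 * K * (I * E)) := by
      simp_rw [ENNReal.ofReal_sum_of_nonneg fun k _ => hF k _]
      rw [expect_sum]
      calc _ ≤ ∑ _k ∈ Finset.Icc 1 (2 * K), ENNReal.ofReal (I * E) := by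
            refine Finset.sum_le_sum fun k hk => ?_
            rw [Finset.mem_Icc] at hk
            refine (expect_rootIdle_mul_decay_le hm hβ hf hk.1 (hk.2.trans hKN) hn hq0
              hqb.le).trans (ENNReal.ofReal_le_ofReal
                (mul_le_mul_of_nonneg_left (Real.exp_le_exp.2 (neg_le_neg ?_)) hI0))
            refine mul_le_mul_of_nonneg_left (sub_le_sub_left ?_ _) (by positivity)
            have : (k : ℝ) ≤ 2 * K := by exact_mod_cast hk.2
            exact Real.log_le_log (by positivity) (by linarith)
        _ = _ := by
            rw [← ENNReal.ofReal_sum_of_nonneg fun _ _ => by positivity]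
            simp
    -- Markov for the sum over k ≤ 2K: on `S₁` it has at least K large terms, each at least
    -- (1/2)·16E, against a mean of at most 2K·I·E. The quotient is I/4.
    refine toOuterMeasure_le_of_expect P S₁ _
      (y := K * ((b - q) / b * Real.exp (-(q * (1 + l)))))
      (mul_pos (by positivity) (mul_pos (div_pos (by linarith) hb) (Real.exp_pos _)))
      (fun G hG hGS => ?_) hE ?_
    · obtain ⟨hidle, hcard⟩ := hGS
      have hγ : 0 ≤ (b - q) / b * Real.exp (-(q * (1 + l))) :=
        mul_nonneg (div_nonneg (by linarith) hb.le) (Real.exp_pos _).le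
      obtain ⟨n', rfl⟩ : ∃ i, n = i + 1 := ⟨n - 1, by omega⟩
      have hatt := (attaching_graphLaw f m n' G hG).succ
      calc _ ≤ ((Finset.Icc 1 (2 * K)).filter fun k =>
            (degree (labels G) k : ℝ) + β ≤ Real.exp l).card *
              ((b - q) / b * Real.exp (-(q * (1 + l)))) :=
            mul_le_mul_of_nonneg_right (by exact_mod_cast hcard) hγ
        _ = ∑ _k ∈ (Finset.Icc 1 (2 * K)).filter fun k =>
            (degree (labels G) k : ℝ) + β ≤ Real.exp l,
              ((b - q) / b * Real.exp (-(q * (1 + l)))) := by simp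
        _ ≤ ∑ k ∈ (Finset.Icc 1 (2 * K)).filter fun k =>
            (degree (labels G) k : ℝ) + β ≤ Real.exp l, F k G := by
            refine Finset.sum_le_sum fun k hk => ?_
            rw [Finset.mem_filter, Finset.mem_Icc] at hk
            simp only [F, hidle, one_mul]
            exact le_decay hm hβ hq0 hqb (hatt.le_degree k (by omega)) hk.2
        _ ≤ _ := Finset.sum_le_sum_of_subset_of_nonneg (Finset.filter_subset _ _)
            fun k _ _ => hF k G
    · have h2 : Real.exp (-(q * (1 + l))) = 16 * E := by
        rw [← Real.exp_log (show (0 : ℝ) < 16 by norm_num), ← Real.exp_add]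
        congr 1
        rw [hl_def, hκ_def, hq_def]
        field_simp
        ring
      have h3 : (b - q) / b = 1 / 2 := by
        rw [hq_def]
        field_simp
        ring
      rw [h2, h3]
      linarith
  have hsub : {G : MultiDigraph (Fin (n + 1)) | rootIdle m N (labels G) = 1} ⊆
      {G | (0 : Fin (n + 1)) ∉ H K n G} ∪ (S₀ ∪ S₁) := by
    intro G hG
    by_cases hG0 : G ∈ S₀
    · exact Or.inr (Or.inl hG0)
    by_cases hG1 : G ∈ S₁
    · exact Or.inr (Or.inr hG1)
    have hx0 : (degree (labels G) 0 : ℝ) + β < Real.exp l := by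
      by_contra! h
      exact hG0 ⟨hG, h⟩
    have hcard : ((Finset.Icc 1 (2 * K)).filter fun k =>
        (degree (labels G) k : ℝ) + β ≤ Real.exp l).card < K := by
      by_contra! h
      exact hG1 ⟨hG, h⟩
    refine Or.inl (hH.notMem_of_card hK ((Finset.Icc 1 (2 * K)).filter fun k =>
        ¬ (degree (labels G) k : ℝ) + β ≤ Real.exp l) ?_ fun k hk => ?_)
    · have h2 := Finset.card_filter_add_card_filter_not (s := Finset.Icc 1 (2 * K))
        (fun k => (degree (labels G) k : ℝ) + β ≤ Real.exp l)
      rw [Nat.card_Icc] at h2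
      omega
    · rw [Finset.mem_filter, Finset.mem_Icc, not_le] at hk
      refine ⟨by omega, ?_⟩
      have h2 := hx0.trans hk.2
      have h3 : (degree (labels G) 0 : ℝ) < degree (labels G) k := by linarith
      exact_mod_cast h3
  have hfinal : ENNReal.ofReal I ≤ P.toOuterMeasure {G | (0 : Fin (n + 1)) ∉ H K n G} +
      ENNReal.ofReal (I / 2) :=
    calc _ ≤ _ := hA
      _ ≤ _ := MeasureTheory.measure_mono hsub
      _ ≤ _ := MeasureTheory.measure_union_le _ _
      _ ≤ P.toOuterMeasure {G | (0 : Fin (n + 1)) ∉ H K n G} +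
          (ENNReal.ofReal (I / 4) + ENNReal.ofReal (I / 4)) :=
        add_le_add le_rfl ((MeasureTheory.measure_union_le _ _).trans (add_le_add h0 h1))
      _ = _ := by
        rw [← ENNReal.ofReal_add (by positivity) (by positivity)]
        congr 2
        ring
  have hI2 : ENNReal.ofReal (I / 2) ≤ P.toOuterMeasure {G | (0 : Fin (n + 1)) ∉ H K n G} := by
    rw [← tsub_le_iff_right, ← ENNReal.ofReal_sub _ (by positivity)] at hfinal
    rwa [show I - I / 2 = I / 2 by ring] at hfinal
  refine le_trans (ENNReal.ofReal_le_ofReal ?_) hI2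
  have h2 := exp_le_idleProb hm hβ hN
  have h3 : Real.log N = Real.log M + Real.log K := by
    simp only [N]
    rw [Nat.cast_mul, Real.log_mul hM0.ne' (by positivity)]
  rw [mul_assoc, ← Real.exp_add]
  rw [h3, ← ha_def, ← hb_def] at h2
  have h4 : -(b * a * (Real.log M + 3)) + -(b * a * Real.log K) =
      -(b * a * (Real.log M + Real.log K + 3)) := by ring
  rw [h4]
  linarith

/-! ### Choice of the parameters -/

theorem sum_Icc_inv_sq_le {K : ℕ} (hK : 1 ≤ K) (n : ℕ) :
    ∑ k ∈ Finset.Icc K n, Real.exp (-(2 * Real.log k)) ≤ 2 := by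
  have h : ∀ n : ℕ, ∑ k ∈ Finset.Icc 1 (n + 1), Real.exp (-(2 * Real.log k)) ≤
      2 - 1 / (n + 1) := by
    have h1 : ∀ k : ℕ, 1 ≤ k → Real.exp (-(2 * Real.log k)) = 1 / (k : ℝ) ^ 2 := by
      intro k hk
      have hk0 : (0 : ℝ) < k := by exact_mod_cast hk
      rw [Real.exp_neg, two_mul, Real.exp_add, Real.exp_log hk0, one_div, sq]
    intro n
    induction n with
    | zero => norm_num
    | succ n ih =>
      rw [Finset.sum_Icc_succ_top (by omega), h1 _ (by omega)]
      have h2 : (1 : ℝ) / (n + 1 + 1) ^ 2 ≤ 1 / (n + 1) - 1 / (n + 1 + 1) := by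
        rw [div_sub_div _ _ (by positivity) (by positivity),
          div_le_div_iff₀ (by positivity) (by positivity)]
        nlinarith [Nat.cast_nonneg (α := ℝ) n]
      push_cast
      linarith
  have h2 : Finset.Icc K n ⊆ Finset.Icc 1 (n + 1) := Finset.Icc_subset_Icc hK (Nat.le_succ n)
  have h3 := Finset.sum_le_sum_of_subset_of_nonneg (f := fun k : ℕ => Real.exp (-(2 * Real.log k)))
    h2 fun _ _ _ => (Real.exp_pos _).le
  have h4 := h n
  have h5 : (0 : ℝ) ≤ 1 / (n + 1) := by positivity
  linarith

/-- The sum over k asks for log K ≥ (D + p + O(1))/a plus an error of order L/p. Balancing p against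
L/p gives p of order √(1+L). -/
theorem exists_parameters {a b L : ℝ} (ha : 0 < a) (ha1 : a ≤ 1) (hb : 1 ≤ b) (hL : 0 ≤ L) {K : ℕ}
    (hK : Real.exp ((L / b + 2 * (b + 5 / a + 15) * √(1 + L)) / a) ≤ K) :
    ∃ (q D : ℝ) (p : ℕ), 0 ≤ q ∧ q < b ∧ ∀ n : ℕ, b / (b - q) * Real.exp (q * (2 - D)) +
      ∑ k ∈ Finset.Icc K n, Real.exp (p * (b + p + 1 + D) - p * a * Real.log k) ≤
        Real.exp (-L) := by
  have hb0 : 0 < b := by linarith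
  set σ : ℝ := √(1 + L) with hσ_def
  have hσ2 : σ * σ = 1 + L := Real.mul_self_sqrt (by linarith)
  have hσ1 : 1 ≤ σ := by
    rw [hσ_def, Real.one_le_sqrt]
    linarith
  have hσ0 : 0 < σ := by linarith
  set p : ℕ := ⌈4 * σ / a⌉₊ with hp_def
  set D : ℝ := 2 + (L + 10 * σ) / b with hD_def
  set T : ℝ := (L / b + 2 * (b + 5 / a + 15) * σ) / a with hT_def
  have hT0 : 0 ≤ T := by positivity
  have hK1 : 1 ≤ K := by
    have : (0 : ℝ) < K := (Real.exp_pos _).trans_le hK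
    exact_mod_cast this
  have hq0 : 0 ≤ b * (1 - 1 / (2 * σ)) := by
    have : 1 / (2 * σ) ≤ 1 := by
      rw [div_le_one (by positivity)]
      linarith
    exact mul_nonneg hb0.le (by linarith)
  have hqb : b * (1 - 1 / (2 * σ)) = b - b / (2 * σ) := by ring
  -- With this q the prefactor b/(b−q) is only 2σ, and qD loses only about L/(2σ) ≤ σ/2 compared
  -- with bD; the term 10σ in D pays for both.
  refine ⟨b * (1 - 1 / (2 * σ)), D, p, hq0, ?_, fun n => ?_⟩
  · have : 0 < b / (2 * σ) := by positivity
    linarith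
  have hroot : b / (b - b * (1 - 1 / (2 * σ))) * Real.exp (b * (1 - 1 / (2 * σ)) * (2 - D)) ≤
      1 / 2 * Real.exp (-L) := by
    have h1 : b / (b - b * (1 - 1 / (2 * σ))) = 2 * σ := by
      rw [hqb, sub_sub_cancel]
      field_simp
    have h2 : b * (1 - 1 / (2 * σ)) * (2 - D) = -L - (10 * σ - L / (2 * σ) - 5) := by
      rw [hD_def]
      field_simp
      ring
    have h3 : L / (2 * σ) ≤ σ / 2 := by
      rw [div_le_iff₀ (by positivity)]
      linarith
    have h4 : 4 * σ ≤ Real.exp (10 * σ - L / (2 * σ) - 5) := by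
      have h5 := Real.add_one_le_exp (10 * σ - L / (2 * σ) - 5)
      linarith
    rw [h1, h2, Real.exp_sub, mul_div_assoc', div_le_iff₀ (Real.exp_pos _)]
    have h6 := mul_le_mul_of_nonneg_left h4 (Real.exp_pos (-L)).le
    linarith
  have hsum : ∑ k ∈ Finset.Icc K n, Real.exp (p * (b + p + 1 + D) - p * a * Real.log k) ≤
      1 / 2 * Real.exp (-L) := by
    set u : ℝ := p * a with hu_def
    have hu4 : 4 * σ ≤ u := by
      rw [hu_def, ← div_le_iff₀ ha]
      exact Nat.le_ceil _
    have hu5 : u ≤ 5 * σ := by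
      have h1 : (p : ℝ) < 4 * σ / a + 1 := Nat.ceil_lt_add_one (by positivity)
      have h2 : u ≤ (4 * σ / a + 1) * a := mul_le_mul_of_nonneg_right h1.le ha.le
      have h3 : (4 * σ / a + 1) * a = 4 * σ + a := by field_simp
      linarith
    have hpu : (p : ℝ) = u / a := by
      rw [hu_def]
      field_simp
    -- Of the exponent u·log k, the part 2·log k is reserved for a convergent sum over k; only u − 2
    -- is available for reaching e^(−L).
    have hkey : p * (b + p + 1 + D) - (u - 2) * T ≤ -L - 2 := by
      have h1 : u * (b + u / a + 3 + (L + 10 * σ) / b) + a * (L + 2) ≤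
          (u - 2) * (L / b + 2 * (b + 5 / a + 15) * σ) := by
        have h2 : b + u / a + 3 + 10 * σ / b ≤ (b + 5 / a + 13) * σ := by
          have h3 : u / a ≤ 5 / a * σ := by
            rw [div_mul_eq_mul_div]
            exact div_le_div_of_nonneg_right hu5 ha.le
          have h4 : 10 * σ / b ≤ 10 * σ := div_le_self (by positivity) hb
          have h5 : b ≤ b * σ := le_mul_of_one_le_right hb0.le hσ1
          linarith
        have h3 : L / b ≤ L := div_le_self hL hb
        have h4 : a * (L + 2) ≤ L + 2 := mul_le_of_le_one_left (by linarith) ha1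
        have h5 : 4 * (σ * σ) ≤ u * σ := by nlinarith
        have h6 := mul_le_mul_of_nonneg_left h2 (show 0 ≤ u by linarith)
        -- Here u ≥ 4σ ≥ 4 gives u − 2 ≥ u/2, which the factor 2 in the definition of T compensates.
        have h7 : (u / 2) * (2 * (b + 5 / a + 15) * σ) ≤ (u - 2) * (2 * (b + 5 / a + 15) * σ) :=
          mul_le_mul_of_nonneg_right (by linarith) (by positivity)
        have h8 : (L + 10 * σ) / b = L / b + 10 * σ / b := add_div _ _ _
        rw [h8]
        nlinarith
      have h2 : p * (b + p + 1 + D) =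
          (u * (b + u / a + 3 + (L + 10 * σ) / b)) / a := by
        rw [hpu, hD_def]
        ring
      have h3 : (u - 2) * T = ((u - 2) * (L / b + 2 * (b + 5 / a + 15) * σ)) / a := by
        rw [hT_def]
        ring
      rw [h2, h3, ← sub_div, div_le_iff₀ ha]
      linarith
    have hterm : ∀ k ∈ Finset.Icc K n, Real.exp (p * (b + p + 1 + D) - p * a * Real.log k) ≤
        Real.exp (-L - 2) * Real.exp (-(2 * Real.log k)) := by
      intro k hk
      rw [← Real.exp_add, Real.exp_le_exp, ← hu_def]
      have hkK : (K : ℝ) ≤ k := by exact_mod_cast (Finset.mem_Icc.1 hk).1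
      have hkpos : (0 : ℝ) < k := lt_of_lt_of_le (by exact_mod_cast hK1) hkK
      have hlog : T ≤ Real.log k := (Real.le_log_iff_exp_le hkpos).2 (hK.trans hkK)
      have h1 := mul_le_mul_of_nonneg_left hlog (show 0 ≤ u - 2 by linarith)
      linarith
    calc _ ≤ _ := Finset.sum_le_sum hterm
      _ ≤ Real.exp (-L - 2) * 2 := by
        rw [← Finset.mul_sum]
        exact mul_le_mul_of_nonneg_left (sum_Icc_inv_sq_le hK1 n) (Real.exp_pos _).le
      _ ≤ _ := by
        rw [Real.exp_sub, div_mul_eq_mul_div, div_le_iff₀ (Real.exp_pos _)]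
        have h1 : (4 : ℝ) ≤ Real.exp 2 := by
          have h2 := Real.add_one_le_exp (1 : ℝ)
          rw [show (2 : ℝ) = 1 + 1 by norm_num, Real.exp_add]
          nlinarith
        have h2 := mul_le_mul_of_nonneg_left h1 (Real.exp_pos (-L)).le
        linarith
  linarith

/-! ### Root finding -/

theorem isRootFinding_of_prob_le {P : (n : ℕ) → PMF (MultiDigraph (Fin (n + 1)))}
    {h : (n : ℕ) → MultiDigraph (Fin (n + 1)) → Finset (Fin (n + 1))} {ε : ℝ} (hε : 0 ≤ ε)
    (hP : ∀ n, 1 ≤ n →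
      (P n).toOuterMeasure {G | (0 : Fin (n + 1)) ∉ h n G} ≤ ENNReal.ofReal ε) :
    IsRootFinding P h ε := by
  refine le_liminf_of_le (by isBoundedDefault) ?_
  filter_upwards [eventually_ge_atTop 1] with n hn
  have h1 := toOuterMeasure_add_compl (P n) {G | (0 : Fin (n + 1)) ∈ h n G}
  rw [ENNReal.ofReal_sub _ hε, ENNReal.ofReal_one, tsub_le_iff_right, ← h1]
  exact add_le_add le_rfl (hP n hn)

theorem IsRootFinding.le_of_le_prob {P : (n : ℕ) → PMF (MultiDigraph (Fin (n + 1)))}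
    {h : (n : ℕ) → MultiDigraph (Fin (n + 1)) → Finset (Fin (n + 1))} {ε x : ℝ}
    (hroot : IsRootFinding P h ε) (hε : ε < 1) (hx : 0 ≤ x)
    (hP : ∀ᶠ n in atTop,
      ENNReal.ofReal x ≤ (P n).toOuterMeasure {G | (0 : Fin (n + 1)) ∉ h n G}) :
    x ≤ ε := by
  have h1 : liminf (fun n => (P n).toOuterMeasure {G | (0 : Fin (n + 1)) ∈ h n G}) atTop ≤
      ENNReal.ofReal (1 - x) := by
    rw [← liminf_const (f := (atTop : Filter ℕ)) (ENNReal.ofReal (1 - x))]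
    refine liminf_le_liminf ?_
    filter_upwards [hP] with n hn
    rw [ENNReal.ofReal_sub _ hx, ENNReal.ofReal_one]
    refine ENNReal.le_sub_of_add_le_right ENNReal.ofReal_ne_top ?_
    rw [← toOuterMeasure_add_compl (P n) {G | (0 : Fin (n + 1)) ∈ h n G}]
    exact add_le_add le_rfl hn
  -- `ENNReal.ofReal` truncates at 0; the alternative 1 − ε ≤ 0 is excluded by ε < 1.
  rcases ENNReal.ofReal_le_ofReal_iff'.1 (hroot.trans h1) with h2 | h2 <;> linarith

theorem exists_budget_eq {P : (n : ℕ) → PMF (MultiDigraph (Fin (n + 1)))} {H : Selection} {ε : ℝ}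
    {K₀ : ℕ} (hK₀ : 1 ≤ K₀) (h : IsRootFinding P (H K₀) ε) :
    ∃ K : ℕ, budget P H ε = (K : ℕ∞) ∧ 1 ≤ K ∧ IsRootFinding P (H K) ε ∧ K ≤ K₀ := by
  classical
  have hex : ∃ K, 1 ≤ K ∧ IsRootFinding P (H K) ε := ⟨K₀, hK₀, h⟩
  refine ⟨Nat.find hex, le_antisymm (sInf_le ⟨_, (Nat.find_spec hex).1, (Nat.find_spec hex).2, rfl⟩)
    (le_sInf ?_), (Nat.find_spec hex).1, (Nat.find_spec hex).2, Nat.find_min' hex ⟨hK₀, h⟩⟩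
  rintro _ ⟨K, hK, hroot, rfl⟩
  exact_mod_cast Nat.find_min' hex ⟨hK, hroot⟩

end RootFinding

end

/-! ### The two-sided bound for the budget -/

open RootFinding in
theorem theorem2p1 (m : ℕ) (hm : 1 ≤ m) (β : ℝ) (hβ : 0 ≤ β) :
    ∃ C₁ C₁' C₂ : ℝ, 0 < C₁ ∧ 0 < C₁' ∧ 0 < C₂ ∧
      ∀ f : ℕ → Set.Ioi (0 : ℝ), (∀ i : ℕ, 1 ≤ i → (f i : ℝ) = i + β) →
      ∀ H : Selection, IsDegreeSelection H →
      ∀ ε : ℝ, 0 < ε → ε < 1 →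
        ∃ K : ℕ, budget (graphLaw f m) H ε = (K : ℕ∞) ∧
          C₁' / ε ^ ((2 * m + β) / (m * (m + β))) ≤ (K : ℝ) ∧
          (K : ℝ) ≤ C₁ / ε ^ ((2 * m + β) / (m * (m + β))) *
            Real.exp (Real.sqrt (C₂ * Real.log (1 / ε))) := by
  obtain ⟨c, hc, hlow⟩ := le_prob_notMem hm hβ
  have ha := growthExponent_pos hm hβ
  have ha1 := growthExponent_le_one hm hβ
  set a := growthExponent m β with ha_def
  have hm1 : (1 : ℝ) ≤ m := by exact_mod_cast hm
  set b : ℝ := m + β with hb_def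
  have hb1 : 1 ≤ b := by linarith
  have hb0 : 0 < b := by linarith
  have hexp : (2 * m + β) / (m * b) = 1 / (a * b) := by
    rw [ha_def, growthExponent]
    field_simp
  set C : ℝ := 2 * (b + 5 / a + 15) / a with hC_def
  have hC : 0 < C := by positivity
  -- The factor 2 absorbs the rounding in ⌈e^T⌉, e^C comes from √(1+L) ≤ 1 + √L, and C² moves C
  -- under the square root. The lower constant is c^(1/(ab)), from solving c·K^(−ab) ≤ ε for K.
  refine ⟨2 * Real.exp C, Real.exp (Real.log c / (a * b)), C ^ 2, by positivity, by positivity,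
    by positivity, ?_⟩
  intro f hf H hH ε hε hε1
  set L := Real.log (1 / ε) with hL_def
  have hLε : Real.log ε = -L := by rw [hL_def, one_div, Real.log_inv, neg_neg]
  have hL : 0 < L := Real.log_pos (by rw [lt_div_iff₀ hε]; linarith)
  have hpow : ∀ x : ℝ, x / ε ^ ((2 * m + β) / (m * b)) = x * Real.exp (L / (a * b)) := by
    intro x
    rw [hexp, Real.rpow_def_of_pos hε, hLε, div_eq_mul_inv, ← Real.exp_neg]
    congr 2
    ring
  rw [hpow, hpow]
  set T : ℝ := (L / b + 2 * (b + 5 / a + 15) * √(1 + L)) / a with hT_def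
  have hT0 : 0 ≤ T := by positivity
  have hK₀ : 1 ≤ ⌈Real.exp T⌉₊ := Nat.one_le_ceil_iff.2 (Real.exp_pos _)
  have hfind : IsRootFinding (graphLaw f m) (H ⌈Real.exp T⌉₊) ε := by
    obtain ⟨q, D, p, hq0, hqb, hqDp⟩ := exists_parameters ha ha1 hb1 hL.le (Nat.le_ceil _)
    refine isRootFinding_of_prob_le hε.le fun n hn => ?_
    refine (prob_notMem_le hm hβ hf hH hK₀ hn hq0 hqb p D).trans (ENNReal.ofReal_le_ofReal ?_)
    refine (hqDp n).trans (le_of_eq ?_)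
    rw [← hLε, Real.exp_log hε]
  obtain ⟨K, hbudget, hK1, hroot, hKK₀⟩ := exists_budget_eq hK₀ hfind
  have hKpos : (0 : ℝ) < K := by exact_mod_cast hK1
  refine ⟨K, hbudget, ?_, ?_⟩
  · have h1 := hroot.le_of_le_prob hε1 (by positivity) (hlow f hf H hH K hK1)
    have h2 := Real.log_le_log (by positivity) h1
    rw [Real.log_mul hc.ne' (Real.exp_pos _).ne', Real.log_exp, hLε] at h2
    rw [← Real.exp_add, ← Real.le_log_iff_exp_le hKpos, ← add_div, div_le_iff₀ (by positivity)]
    linarith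
  · have h1 : √(1 + L) ≤ 1 + √L := by
      rw [Real.sqrt_le_left (by positivity)]
      nlinarith [Real.sq_sqrt hL.le, Real.sqrt_nonneg L]
    have h2 : T ≤ L / (a * b) + C + √(C ^ 2 * L) := by
      rw [Real.sqrt_mul (by positivity), Real.sqrt_sq hC.le]
      have h3 : T = L / (a * b) + C * √(1 + L) := by
        rw [hT_def, hC_def]
        field_simp
      have h4 := mul_le_mul_of_nonneg_left h1 hC.le
      linarith
    calc (K : ℝ) ≤ ⌈Real.exp T⌉₊ := by exact_mod_cast hKK₀
      _ ≤ Real.exp T + 1 := (Nat.ceil_lt_add_one (Real.exp_pos _).le).le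
      _ ≤ 2 * Real.exp T := by linarith [Real.one_le_exp hT0]
      _ ≤ 2 * Real.exp (L / (a * b) + C + √(C ^ 2 * L)) := by
        linarith [Real.exp_le_exp.2 h2]
      _ = _ := by
        rw [Real.exp_add, Real.exp_add]
        ring
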